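/- **Setting.** Fix a universe of small sets. $\mathsf{Topoi}$ is the 2-category of Grothendieck topoi, geometric morphisms, and natural transformations between inverse images. $\mathsf{Psh}(\mathcal C)$ denotes presheaves of small sets on a small category $\mathcal C$; when $\mathcal C$ is lex (has finite limits) it is called a free topos. Let $\mathcal H$ be any class of geometric morphisms. *Injectivity.* A topos $\mathcal X$ is an object of $\mathsf{WRInj}(\mathcal H)$ if for every $f:\mathcal E\to\mathcal F$ in $\mathcal H$ and every $x:\mathcal E\to\mathcal X$ the right Kan extension $\mathsf{ran}_f x$ exists in $\mathsf{Topoi}$ (its counit need not be invertible). A geometric morphism $h:\mathcal X\to\mathcal Y$ is a 1-cell of $\mathsf{WRInj}(\mathcal H)$ if composition with $h$ preserves all right Kan extensions into $\mathcal X$ along members of $\mathcal H$. All 2-cells are kept. $\mathsf{WRInj}_{\mathsf{pw}}(\mathcal H)$ is the full sub-2-category of $\mathsf{WRInj}(\mathcal H)$ on the topoi $\mathcal X$ into which all right Kan extensions along members of $\mathcal H$ are *pointwise*: the mate $x_*\Rightarrow(\mathsf{ran}_fx)_*f_*$ of the counit exhibits $(\mathsf{ran}_fx)_*$ as the left Kan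 extension of $x_*$ along $f_*$ in the 2-category of lex categories, lex functors and natural transformations. An *$\mathcal H$-presentation* of $\mathcal X\in\mathsf{WRInj}(\mathcal H)$ is a geometric embedding $\mathcal X\hookrightarrow\mathsf{Psh}(\mathcal C)$ into a free topos which is a 1-cell of $\mathsf{WRInj}(\mathcal H)$. *Algebras.* For a small lex category $\mathcal C$, let $\mathsf T^{\mathcal H}(\mathcal C)\subseteq\mathsf{Psh}(\mathcal C)$ be the full subcategory of those presheaves classified by a geometric morphism $\mathsf{Psh}(\mathcal C)\to\mathsf{Set}[\mathbb O]$ to the object classifier which is a 1-cell of $\mathsf{WRInj}(\mathcal H)$. It contains the representables; let $\eta_{\mathcal C}:\mathcal C\to\mathsf T^{\mathcal H}(\mathcal C)$ be the corestricted Yoneda embedding. A *small $\mathsf T^{\mathcal H}$-algebra* is a small lex category $\mathcal C$ with a lex left adjoint $a:\mathsf T^{\mathcal H}(\mathcal C)\to\mathcal C$ of $\eta_{\mathcal C}$. A *morphism of algebras* $g:\mathcal C\to\mathcal D$ is a lex functor preserving all left Kan extensions, among lex functors, of lex functors $\mathcal A\to\mathcal C$ along $\eta_{\mathcal A}$, for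 small lex $\mathcal A$. With all natural transformations as 2-cells these form $\mathsf{alg}(\mathsf T^{\mathcal H})$. *Classifying topos.* For a small algebra $\mathcal C$, the unit of $a\dashv\eta_{\mathcal C}$ gives maps $\delta_X:X\to \mathsf y(aX)$ in $\mathsf{Psh}(\mathcal C)$, for $X\in\mathsf T^{\mathcal H}(\mathcal C)$. Let $J_{\mathcal C}$ be the least Grothendieck topology on $\mathcal C$ whose sheafification inverts every $\delta_X$, and put $\mathsf{Cl}(\mathcal C)=\mathsf{Sh}(\mathcal C,J_{\mathcal C})$, with canonical inclusion $j_{\mathcal C}:\mathsf{Cl}(\mathcal C)\hookrightarrow\mathsf{Psh}(\mathcal C)$. An algebra morphism $g:\mathcal C\to\mathcal D$ is a morphism of sites $(\mathcal C,J_{\mathcal C})\to(\mathcal D,J_{\mathcal D})$, and $\mathsf{Cl}(g):\mathsf{Cl}(\mathcal D)\to\mathsf{Cl}(\mathcal C)$ is the geometric morphism with direct image $F\mapsto F\circ g^{\mathrm{op}}$; 2-cells are sent to the 2-cells whose mates are given by restriction. This defines a pseudofunctor $\mathsf{Cl}:\mathsf{alg}(\mathsf T^{\mathcal H})\to\mathsf{Topoi}^{\mathrm{op}}$,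 where $(-)^{\mathrm{op}}$ reverses 1-cells only. **Theorem (conceptual soundness).** Let $\mathcal H$ be a class of geometric morphisms. 1. For every small $\mathsf T^{\mathcal H}$-algebra $\mathcal C$, the topos $\mathsf{Cl}(\mathcal C)$ lies in $\mathsf{WRInj}(\mathcal H)$. 2. For every small $\mathsf T^{\mathcal H}$-algebra $\mathcal C$, the inclusion $j_{\mathcal C}:\mathsf{Cl}(\mathcal C)\hookrightarrow\mathsf{Psh}(\mathcal C)$ is an $\mathcal H$-presentation of $\mathsf{Cl}(\mathcal C)$. 3. For every morphism $g:\mathcal C\to\mathcal D$ of small $\mathsf T^{\mathcal H}$-algebras, $\mathsf{Cl}(g):\mathsf{Cl}(\mathcal D)\to\mathsf{Cl}(\mathcal C)$ preserves all right Kan extensions into $\mathsf{Cl}(\mathcal D)$ along members of $\mathcal H$, that is, it is a 1-cell of $\mathsf{WRInj}(\mathcal H)$. 4. $\mathsf{Cl}$ factors through the locally full sub-2-category $\mathsf{WRInj}_{\mathsf{pw}}(\mathcal H)$: there is a pseudofunctor $\mathsf{alg}(\mathsf T^{\mathcal H})\to\mathsf{WRInj}_{\mathsf{pw}}(\mathcal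 H)^{\mathrm{op}}$ whose composite with the inclusion $\mathsf{WRInj}_{\mathsf{pw}}(\mathcal H)^{\mathrm{op}}\to\mathsf{Topoi}^{\mathrm{op}}$ is $\mathsf{Cl}$. -/

import Mathlib

set_option linter.unusedSectionVars false

open CategoryTheory Bicategory Limits Opposite

universe w v u

namespace KanLogic

section Bicat

variable {B : Type u} [Bicategory.{w, v} B]

/-- `(r, κ)` is a right Kan extension of `x` along `f` in a bicategory. -/
def IsRan {a b x : B} {f : a ⟶ b} {p : a ⟶ x} (r : b ⟶ x) (κ : f ≫ r ⟶ p) : Prop :=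
  ∀ (y : b ⟶ x) (β : f ≫ y ⟶ p), ∃! γ : y ⟶ r, f ◁ γ ≫ κ = β

/-- `x` is weakly right Kan injective with respect to `f`. -/
def WeakRightKanInjective {a b : B} (f : a ⟶ b) (x : B) : Prop :=
  ∀ p : a ⟶ x, ∃ (r : b ⟶ x) (κ : f ≫ r ⟶ p), IsRan r κ

/-- `h` preserves every right Kan extension along `f`. -/
def PreservesRan {a b : B} (f : a ⟶ b) {x y : B} (h : x ⟶ y) : Prop :=
  ∀ (p : a ⟶ x) (r : b ⟶ x) (κ : f ≫ r ⟶ p), IsRan r κ →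
    IsRan (r ≫ h) ((α_ f r h).inv ≫ κ ▷ h)

theorem IsRan.of_iso {a b x : B} {f : a ⟶ b} {p p' : a ⟶ x} {r r' : b ⟶ x} {κ : f ≫ r ⟶ p}
    {κ' : f ≫ r' ⟶ p'} (h : IsRan r κ) (e : r ≅ r') (i : p ≅ p')
    (w : f ◁ e.hom ≫ κ' = κ ≫ i.hom) : IsRan r' κ' := by
  intro y β
  obtain ⟨γ, hγ, hu⟩ := h y (β ≫ i.inv)
  refine ⟨γ ≫ e.hom, ?_, fun γ' hγ' => ?_⟩
  · simp only [whiskerLeft_comp, Category.assoc, w]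
    rw [← Category.assoc, hγ]
    simp
  · rw [← hu (γ' ≫ e.inv), Category.assoc, e.inv_hom_id, Category.comp_id]
    have : κ = f ◁ e.hom ≫ κ' ≫ i.inv := by rw [← Category.assoc, w]; simp
    simp only [this, whiskerLeft_comp, Category.assoc]
    rw [← Bicategory.whiskerLeft_comp_assoc f e.inv e.hom]
    simp only [Iso.inv_hom_id, Bicategory.whiskerLeft_id, Category.id_comp]
    rw [← Category.assoc, hγ']

theorem PreservesRan.id {a b : B} (f : a ⟶ b) (x : B) : PreservesRan f (𝟙 x) := by
  intro p r κ h
  refine h.of_iso (ρ_ r).symm (ρ_ p).symm ?_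
  simp

theorem PreservesRan.comp {a b : B} {f : a ⟶ b} {x y z : B} {h : x ⟶ y} {k : y ⟶ z}
    (hh : PreservesRan f h) (hk : PreservesRan f k) : PreservesRan f (h ≫ k) := by
  intro p r κ H
  refine (hk _ _ _ (hh _ _ _ H)).of_iso (α_ r h k) (α_ p h k) ?_
  simp only [comp_whiskerRight, Category.assoc, whiskerRight_comp]
  simp

/-- A 1-cell with a left adjoint preserves all right Kan extensions. -/
theorem PreservesRan.of_adjunction {a b : B} (f : a ⟶ b) {x y : B} {l : y ⟶ x} {h : x ⟶ y}
    (adj : l ⊣ h) : PreservesRan f h := by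
  intro p r κ H y β
  obtain ⟨γ, hγ, hu⟩ := H (y ≫ l) ((α_ f y l).inv ≫ adj.homEquiv₂.symm β)
  have key : ∀ δ : y ≫ l ⟶ r, f ◁ adj.homEquiv₂ δ ≫ (α_ f r h).inv ≫ κ ▷ h =
      adj.homEquiv₂ ((α_ f y l).hom ≫ f ◁ δ ≫ κ) := by
    intro δ
    simp only [Adjunction.homEquiv₂_apply]
    simp
  refine ⟨adj.homEquiv₂ γ, ?_, fun γ' hγ' => ?_⟩
  · change f ◁ adj.homEquiv₂ γ ≫ _ = β
    rw [key, hγ]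
    simp
  · rw [← hu (adj.homEquiv₂.symm γ'), Equiv.apply_symm_apply]
    rw [← Equiv.apply_symm_apply adj.homEquiv₂ γ', key, ← Equiv.eq_symm_apply] at hγ'
    simp [← hγ']

/-- The data of a locally full sub-bicategory: classes of objects and of 1-cells, the latter
closed under identities and composition. -/
structure LocallyFull (B : Type u) [Bicategory.{w, v} B] where
  /-- the objects -/
  ob : B → Prop
  /-- the 1-cells -/
  mor : ∀ ⦃a b : B⦄, (a ⟶ b) → Prop
  id_mem : ∀ a : B, mor (𝟙 a)
  comp_mem : ∀ ⦃a b c : B⦄ (f : a ⟶ b) (g : b ⟶ c), mor f → mor g → mor (f ≫ g)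

namespace LocallyFull

variable (S : LocallyFull B)

/-- The objects of the sub-bicategory. -/
structure Sub where
  /-- the underlying object -/
  obj : B
  mem : S.ob obj

variable {S}

/-- The 1-cells of the sub-bicategory. -/
structure Hom (X Y : S.Sub) where
  /-- the underlying 1-cell -/
  hom : X.obj ⟶ Y.obj
  mem : S.mor hom

/-- The 2-cells of the sub-bicategory: all the 2-cells of the ambient bicategory. -/
@[ext]
structure Hom₂ {X Y : S.Sub} (f g : Hom X Y) where
  /-- the underlying 2-cell -/
  hom : f.hom ⟶ g.hom

instance : CategoryStruct S.Sub where
  Hom X Y := Hom X Y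
  id X := ⟨𝟙 X.obj, S.id_mem _⟩
  comp f g := ⟨f.hom ≫ g.hom, S.comp_mem _ _ f.mem g.mem⟩

instance (X Y : S.Sub) : Category (X ⟶ Y) where
  Hom f g := Hom₂ f g
  id f := ⟨𝟙 f.hom⟩
  comp η θ := ⟨η.hom ≫ θ.hom⟩

@[simp] theorem id_hom (X : S.Sub) : Hom.hom (𝟙 X) = 𝟙 X.obj := rfl
@[simp] theorem comp_hom {X Y Z : S.Sub} (f : X ⟶ Y) (g : Y ⟶ Z) :
    Hom.hom (f ≫ g) = Hom.hom f ≫ Hom.hom g := rfl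
@[simp] theorem id_hom₂ {X Y : S.Sub} (f : X ⟶ Y) : Hom₂.hom (𝟙 f) = 𝟙 (Hom.hom f) := rfl
@[simp] theorem comp_hom₂ {X Y : S.Sub} {f g h : X ⟶ Y} (η : f ⟶ g) (θ : g ⟶ h) :
    Hom₂.hom (η ≫ θ) = Hom₂.hom η ≫ Hom₂.hom θ := rfl
@[ext] theorem hom₂_ext {X Y : S.Sub} {f g : X ⟶ Y} {η θ : f ⟶ g}
    (h : Hom₂.hom η = Hom₂.hom θ) : η = θ := Hom₂.ext h

/-- Constructor for 2-cells. -/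
@[simps] def mk₂ {X Y : S.Sub} {f g : X ⟶ Y} (η : Hom.hom f ⟶ Hom.hom g) : f ⟶ g := ⟨η⟩

/-- Invertible 2-cells of the sub-bicategory. -/
@[simps] def isoMk {X Y : S.Sub} {f g : X ⟶ Y} (e : Hom.hom f ≅ Hom.hom g) : f ≅ g where
  hom := ⟨e.hom⟩
  inv := ⟨e.inv⟩

@[simps! whiskerLeft_hom whiskerRight_hom associator_hom_hom associator_inv_hom
  leftUnitor_hom_hom leftUnitor_inv_hom rightUnitor_hom_hom rightUnitor_inv_hom]
instance : Bicategory S.Sub where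
  whiskerLeft f g h η := mk₂ (f := f ≫ g) (g := f ≫ h) (Hom.hom f ◁ Hom₂.hom η)
  whiskerRight {_ _ _ f g} η h := mk₂ (f := f ≫ h) (g := g ≫ h) (Hom₂.hom η ▷ Hom.hom h)
  associator f g h := isoMk (f := (f ≫ g) ≫ h) (g := f ≫ g ≫ h) (α_ (Hom.hom f) (Hom.hom g) (Hom.hom h))
  leftUnitor {X _} f := isoMk (f := 𝟙 X ≫ f) (λ_ (Hom.hom f))
  rightUnitor {_ Y} f := isoMk (f := f ≫ 𝟙 Y) (ρ_ (Hom.hom f))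
  whisker_exchange _ _ := by ext; exact whisker_exchange _ _

/-- The inclusion of the sub-bicategory, with 1-cells reversed on both sides. -/
def inclOp (S : LocallyFull B) : S.Subᵒᵖ ⥤ᵖ Bᵒᵖ where
  obj X := op X.unop.obj
  map f := (Hom.hom f.unop).op
  map₂ η := Bicategory.Opposite.op2 (Hom₂.hom η.unop2)
  mapId _ := Iso.refl _
  mapComp _ _ := Iso.refl _

end LocallyFull

end Bicat

/-- `(L, α)` is a left Kan extension of `F` along `P` among left exact functors. -/
def IsLexLan {C D E : Type*} [Category* C] [Category* D] [Category* E] (P : C ⥤ D) (F : C ⥤ E)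
    (L : D ⥤ E) (α : F ⟶ P ⋙ L) : Prop :=
  PreservesFiniteLimits L ∧ ∀ (K : D ⥤ E), PreservesFiniteLimits K →
    ∀ β : F ⟶ P ⋙ K, ∃! γ : L ⟶ K, α ≫ P.whiskerLeft γ = β

section Topoi

/-- A Grothendieck topos: a category equivalent to the sheaves on a small site. -/
structure Topos : Type (u + 2) where
  /-- the underlying category -/
  carrier : Type (u + 1)
  [cat : Category.{u} carrier]
  isTopos : ∃ (C : Type u) (_ : SmallCategory C) (J : GrothendieckTopology C),
    Nonempty (carrier ≌ Sheaf J (Type u))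

instance : CoeSort Topos.{u} (Type (u + 1)) := ⟨Topos.carrier⟩
attribute [instance] Topos.cat

/-- A geometric morphism. -/
structure GeomMor (E F : Topos.{u}) where
  /-- the direct image -/
  direct : E ⥤ F
  /-- the inverse image -/
  inverse : F ⥤ E
  /-- the inverse image is left adjoint to the direct image -/
  adj : inverse ⊣ direct
  lex : PreservesFiniteLimits inverse

namespace Topos

instance : CategoryStruct Topos.{u} where
  Hom E F := GeomMor E F
  id _ := ⟨𝟭 _, 𝟭 _, .id, inferInstance⟩
  comp f g := ⟨f.direct ⋙ g.direct, g.inverse ⋙ f.inverse, g.adj.comp f.adj,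
    have := f.lex; have := g.lex; comp_preservesFiniteLimits _ _⟩

variable {E F G : Topos.{u}}

/-- A 2-cell between geometric morphisms: a natural transformation between inverse images. -/
@[ext]
structure Hom₂ (f g : E ⟶ F) where
  /-- the natural transformation of inverse images -/
  nat : GeomMor.inverse f ⟶ GeomMor.inverse g

instance : Category (E ⟶ F) where
  Hom f g := Hom₂ f g
  id f := ⟨𝟙 _⟩
  comp α β := ⟨α.nat ≫ β.nat⟩

@[simp] theorem id_direct : GeomMor.direct (𝟙 E) = 𝟭 _ := rfl
@[simp] theorem id_inverse : GeomMor.inverse (𝟙 E) = 𝟭 _ := rfl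
@[simp] theorem comp_direct (f : E ⟶ F) (g : F ⟶ G) :
    GeomMor.direct (f ≫ g) = f.direct ⋙ g.direct := rfl
@[simp] theorem comp_inverse (f : E ⟶ F) (g : F ⟶ G) :
    GeomMor.inverse (f ≫ g) = g.inverse ⋙ f.inverse := rfl
@[simp] theorem id_nat (f : E ⟶ F) : Hom₂.nat (𝟙 f) = 𝟙 f.inverse := rfl
@[simp] theorem comp_nat {f g h : E ⟶ F} (α : f ⟶ g) (β : g ⟶ h) :
    Hom₂.nat (α ≫ β) = α.nat ≫ β.nat := rfl
@[ext] theorem hom₂_ext {f g : E ⟶ F} {α β : f ⟶ g} (h : Hom₂.nat α = Hom₂.nat β) : α = β :=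
  Hom₂.ext h

/-- Constructor for 2-cells. -/
@[simps] def mk₂ {f g : E ⟶ F} (η : GeomMor.inverse f ⟶ GeomMor.inverse g) : f ⟶ g := ⟨η⟩

/-- Invertible 2-cells from isomorphisms of inverse images. -/
@[simps] def isoMk {f g : E ⟶ F} (e : GeomMor.inverse f ≅ GeomMor.inverse g) : f ≅ g where
  hom := ⟨e.hom⟩
  inv := ⟨e.inv⟩

/-- The bicategory of Grothendieck topoi. -/
@[simps! whiskerLeft_nat whiskerRight_nat associator_hom_nat associator_inv_nat
  leftUnitor_hom_nat leftUnitor_inv_nat rightUnitor_hom_nat rightUnitor_inv_nat]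
instance : Bicategory Topos.{u} where
  whiskerLeft f g h η := mk₂ (f := f ≫ g) (g := f ≫ h) (Functor.whiskerRight (Hom₂.nat η) (GeomMor.inverse f))
  whiskerRight {_ _ _ f g} η h := mk₂ (f := f ≫ h) (g := g ≫ h) (Functor.whiskerLeft (GeomMor.inverse h) (Hom₂.nat η))
  associator f g h := isoMk (f := (f ≫ g) ≫ h) (g := f ≫ g ≫ h)
    (Functor.associator h.inverse g.inverse f.inverse).symm
  leftUnitor {E F} f := isoMk (f := 𝟙 E ≫ f) (Functor.rightUnitor f.inverse)
  rightUnitor {E F} f := isoMk (f := f ≫ 𝟙 F) (Functor.leftUnitor f.inverse)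

/-- The mate of a 2-cell: the transformation of direct images in the opposite direction. -/
def mate {f g : E ⟶ F} (α : f ⟶ g) : GeomMor.direct g ⟶ GeomMor.direct f :=
  conjugateEquiv g.adj f.adj α.nat

theorem mate_injective {f g : E ⟶ F} {α β : f ⟶ g} (h : mate α = mate β) : α = β :=
  hom₂_ext ((conjugateEquiv g.adj f.adj).injective h)

/-- The 2-cell with a given mate. -/
def ofMate {f g : E ⟶ F} (τ : GeomMor.direct g ⟶ GeomMor.direct f) : f ⟶ g :=
  mk₂ ((conjugateEquiv g.adj f.adj).symm τ)

@[simp] theorem mate_ofMate {f g : E ⟶ F} (τ : GeomMor.direct g ⟶ GeomMor.direct f) :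
    mate (ofMate τ) = τ := (conjugateEquiv g.adj f.adj).apply_symm_apply τ

@[simp] theorem mate_id (f : E ⟶ F) : mate (𝟙 f) = 𝟙 f.direct := conjugateEquiv_id _

@[simp] theorem mate_comp {f g h : E ⟶ F} (α : f ⟶ g) (β : g ⟶ h) :
    mate (α ≫ β) = mate β ≫ mate α := (conjugateEquiv_comp h.adj g.adj f.adj _ _).symm

@[simp] theorem mate_whiskerLeft (f : E ⟶ F) {g h : F ⟶ G} (α : g ⟶ h) :
    mate (f ◁ α) = Functor.whiskerLeft f.direct (mate α) :=
  conjugateEquiv_whiskerRight _ _ _ _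

@[simp] theorem mate_whiskerRight {f g : E ⟶ F} (α : f ⟶ g) (h : F ⟶ G) :
    mate (α ▷ h) = Functor.whiskerRight (mate α) h.direct :=
  conjugateEquiv_whiskerLeft _ _ _ _

theorem mate_inv_of {f g : E ⟶ F} (e : f ≅ g) {a : GeomMor.direct g ⟶ GeomMor.direct f}
    {b : GeomMor.direct f ⟶ GeomMor.direct g} (h : mate e.hom = a) (hab : a ≫ b = 𝟙 _) :
    mate e.inv = b := by
  have h1 : mate e.inv ≫ mate e.hom = 𝟙 _ := by rw [← mate_comp, e.hom_inv_id, mate_id]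
  rw [← Category.comp_id (mate e.inv), ← hab, ← h, ← Category.assoc, h1, Category.id_comp]

@[simp] theorem mate_associator_inv {K : Topos.{u}} (f : E ⟶ F) (g : F ⟶ G) (h : G ⟶ K) :
    mate (α_ f g h).inv = (Functor.associator f.direct g.direct h.direct).hom :=
  conjugateEquiv_associator_hom _ _ _

@[simp] theorem mate_associator_hom {K : Topos.{u}} (f : E ⟶ F) (g : F ⟶ G) (h : G ⟶ K) :
    mate (α_ f g h).hom = (Functor.associator f.direct g.direct h.direct).inv :=
  mate_inv_of (α_ f g h).symm (mate_associator_inv f g h) (by simp)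

@[simp] theorem mate_leftUnitor_hom (f : E ⟶ F) :
    mate (λ_ f).hom = (Functor.leftUnitor f.direct).inv :=
  conjugateEquiv_rightUnitor_hom _

@[simp] theorem mate_rightUnitor_hom (f : E ⟶ F) :
    mate (ρ_ f).hom = (Functor.rightUnitor f.direct).inv :=
  conjugateEquiv_leftUnitor_hom _

/-- Invertible 2-cells from isomorphisms of direct images. -/
@[simps] def isoOfMate {f g : E ⟶ F} (e : GeomMor.direct g ≅ GeomMor.direct f) : f ≅ g where
  hom := ofMate e.hom
  inv := ofMate e.inv
  hom_inv_id := mate_injective (by simp)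
  inv_hom_id := mate_injective (by simp)

/-- The right Kan extension `(r, κ)` in topoi is pointwise: passing to direct images yields a
left Kan extension among left exact functors, that is, a right Kan extension in the 2-category of
topoi and left exact functors with reversed 2-cells. -/
def IsPointwise {f : E ⟶ F} {p : E ⟶ G} (r : F ⟶ G) (κ : f ≫ r ⟶ p) : Prop :=
  IsLexLan f.direct p.direct r.direct (mate κ)

/-- A geometric embedding. -/
def IsEmbedding (j : E ⟶ F) : Prop := j.direct.Full ∧ j.direct.Faithful

/-- An adjunction in the bicategory of topoi from an adjunction of inverse images. -/
def adjunctionOfInverse {l : F ⟶ E} {h : E ⟶ F} (adj : h.inverse ⊣ l.inverse) : l ⊣ h where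
  unit := mk₂ (f := 𝟙 F) (g := l ≫ h) adj.unit
  counit := mk₂ (f := h ≫ l) (g := 𝟙 E) adj.counit
  left_triangle := by
    ext X
    simp [leftZigzag, bicategoricalComp]
  right_triangle := by
    ext X
    simp [rightZigzag, bicategoricalComp]

/-- The topos of presheaves on a small category. -/
def psh (C : Type u) [SmallCategory C] : Topos.{u} where
  carrier := Cᵒᵖ ⥤ Type u
  isTopos := ⟨C, inferInstance, ⊥, ⟨(sheafBotEquivalence (Type u)).symm⟩⟩

/-- The topos of sheaves on a small site. -/
def sh {C : Type u} [SmallCategory C] (J : GrothendieckTopology C) : Topos.{u} where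
  carrier := Sheaf J (Type u)
  isTopos := ⟨C, inferInstance, J, ⟨.refl⟩⟩

/-- The inclusion of sheaves into presheaves. -/
noncomputable def shIncl {C : Type u} [SmallCategory C] (J : GrothendieckTopology C) : sh J ⟶ psh C where
  direct := sheafToPresheaf J (Type u)
  inverse := presheafToSheaf J (Type u)
  adj := sheafificationAdjunction J (Type u)
  lex := HasSheafify.isLeftExact

section

variable {C D : Type u} [SmallCategory C] [SmallCategory D]

/-- The geometric morphism `psh D ⟶ psh C` whose direct image is precomposition with `g`. -/
noncomputable def pshMap (g : C ⥤ D) [RepresentablyFlat g] : psh D ⟶ psh C where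
  direct := (Functor.whiskeringLeft _ _ (Type u)).obj g.op
  inverse := g.op.lan
  adj := g.op.lanAdjunction (Type u)
  lex := lan_preservesFiniteLimits_of_flat (Type u) g

/-- The left adjoint of `pshMap g`, whose inverse image is precomposition with `g`. -/
noncomputable def pshMapLeft (g : C ⥤ D) : psh C ⟶ psh D where
  direct := g.op.ran
  inverse := (Functor.whiskeringLeft _ _ (Type u)).obj g.op
  adj := g.op.ranAdjunction (Type u)
  lex := ⟨fun J _ _ => whiskeringLeft_preservesLimitsOfShape J g.op⟩

/-- `pshMap g` is a right adjoint in the bicategory of topoi. -/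
noncomputable def pshMapAdj (g : C ⥤ D) [RepresentablyFlat g] : pshMapLeft g ⊣ pshMap g :=
  adjunctionOfInverse (g.op.lanAdjunction (Type u))

end

/-- The object classifier, presheaves on the opposite of the category of finite sets. -/
def setO : Topos.{u} := psh FintypeCat.Skeleton.{u}ᵒᵖ

/-- The generic object: the inclusion of finite sets into sets, represented by the
one-element set. -/
def generic : setO.{u} := yoneda.obj (op (FintypeCat.Skeleton.mk 1))

/-- A fragment of logic: a class of geometric morphisms. -/
abbrev _root_.KanLogic.Logic := ∀ ⦃E F : Topos.{u}⦄, (E ⟶ F) → Prop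

end Topos
end Topoi

section Logic

open Topos

/-- The locally full sub-bicategory of topoi weakly right Kan injective with respect to all
members of `H`, with the geometric morphisms preserving these right Kan extensions. -/
def WRInj (H : Logic.{u}) : LocallyFull Topos.{u} where
  ob X := ∀ ⦃E F : Topos.{u}⦄ (f : E ⟶ F), H f → WeakRightKanInjective f X
  mor _ _ h := ∀ ⦃E F : Topos.{u}⦄ (f : E ⟶ F), H f → PreservesRan f h
  id_mem _ _ _ f _ := PreservesRan.id f _
  comp_mem _ _ _ _ _ hf hg _ _ f h := (hf f h).comp (hg f h)

/-- The full sub-bicategory of `WRInj H` on the topoi into which all right Kan extensions along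
members of `H` are pointwise. -/
def WRInjPw (H : Logic.{u}) : LocallyFull Topos.{u} where
  ob X := (WRInj H).ob X ∧ ∀ ⦃E F : Topos.{u}⦄ (f : E ⟶ F), H f →
    ∀ (p : E ⟶ X) (r : F ⟶ X) (κ : f ≫ r ⟶ p), IsRan r κ → IsPointwise r κ
  mor := (WRInj H).mor
  id_mem := (WRInj H).id_mem
  comp_mem := (WRInj H).comp_mem

/-- `j : X ⟶ psh C` is an `H`-presentation of `X`: a geometric embedding into the free topos on a
small left exact category, and a 1-cell between objects of `WRInj H`. -/
structure IsPresentation (H : Logic.{u}) {X : Topos.{u}} {C : Type u} [SmallCategory C]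
    [HasFiniteLimits C] (j : X ⟶ psh C) : Prop where
  source_mem : (WRInj H).ob X
  target_mem : (WRInj H).ob (psh C)
  mor_mem : (WRInj H).mor j
  isEmbedding : IsEmbedding j

/-- The objects of the syntactic category of `X`, as objects of `X`: those classified by a
geometric morphism to the object classifier which lies in `WRInj H`. -/
def syn (H : Logic.{u}) (X : Topos.{u}) : ObjectProperty X := fun A =>
  ∃ p : X ⟶ setO, (WRInj H).mor p ∧ Nonempty (p.inverse.obj generic ≅ A)

variable (H : Logic.{u})

/-- The objects of the syntactic category of the free topos on `C`, as presheaves on `C`. -/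
def freeSyn (C : Type u) [SmallCategory C] : ObjectProperty (Cᵒᵖ ⥤ Type u) := syn H (psh C)

/-- The doctrine of `H` at a small left exact category `C`: the syntactic category of the free
topos on `C`. -/
abbrev T (C : Type u) [SmallCategory C] := (freeSyn H C).FullSubcategory

section Representables

variable {C : Type u} [SmallCategory C] [HasFiniteLimits C]

/-- The left exact functor on the opposite of finite sets sending a finite set to the
corresponding power of `c`. -/
noncomputable def power (c : C) : FintypeCat.Skeleton.{u}ᵒᵖ ⥤ C where
  obj n := ∏ᶜ fun _ : ULift.{u} (Fin n.unop.len) => c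
  map {m n} f := Pi.lift fun i => Pi.π (fun _ : ULift.{u} (Fin m.unop.len) => c) (f.unop i)
  map_id n := by
    apply limit.hom_ext
    rintro ⟨i⟩
    simp
    rfl
  map_comp f g := by
    apply limit.hom_ext
    rintro ⟨i⟩
    simp
    rfl

instance : HasFiniteColimits FintypeCat.Skeleton.{u} where
  out _ _ _ := Adjunction.hasColimitsOfShape_of_equivalence FintypeCat.Skeleton.incl

/-- Maps into a power are families of maps. -/
noncomputable def powerCoyonedaIso (c d : C) :
    power c ⋙ coyoneda.obj (op d) ≅
      (FintypeCat.Skeleton.incl ⋙ FintypeCat.incl).op ⋙ yoneda.obj (d ⟶ c) :=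
  NatIso.ofComponents (fun n =>
    { hom := ↾fun φ => ↾fun i => φ ≫ Pi.π (fun _ : ULift.{u} (Fin n.unop.len) => c) i
      inv := ↾fun φ => Pi.lift (f := fun _ : ULift.{u} (Fin n.unop.len) => c)
        fun i => (ConcreteCategory.hom (C := Type u) φ) i
      hom_inv_id := by
        ext φ
        apply limit.hom_ext
        rintro ⟨i⟩
        exact Pi.lift_π _ i
      inv_hom_id := by
        ext φ
        apply ConcreteCategory.hom_ext
        intro i
        exact Pi.lift_π (f := fun _ : ULift.{u} (Fin n.unop.len) => c) _ i })
    (fun f => by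
      ext φ
      apply ConcreteCategory.hom_ext
      intro i
      change (d ⟶ ∏ᶜ fun _ : ULift.{u} (Fin _) => c) at φ
      change (φ ≫ Pi.lift fun j => Pi.π (fun _ : ULift.{u} (Fin _) => c) (f.unop j)) ≫
        Pi.π (fun _ : ULift.{u} (Fin _) => c) i = φ ≫ Pi.π _ (f.unop i)
      refine (Category.assoc _ _ _).trans ?_
      exact congrArg (φ ≫ ·) (Pi.lift_π (f := fun _ : ULift.{u} (Fin _) => c) _ _))

instance power_lex (c : C) : PreservesFiniteLimits (power c) where
  preservesFiniteLimits J _ _ := ⟨fun {K} => ⟨fun {s} hs => ⟨by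
    apply coyonedaJointlyReflectsLimits
    intro d
    have : PreservesFiniteLimits (FintypeCat.Skeleton.incl.{u} ⋙ FintypeCat.incl.{u}).op := by
      have : PreservesFiniteColimits (FintypeCat.Skeleton.incl.{u} ⋙ FintypeCat.incl.{u}) :=
        comp_preservesFiniteColimits _ _
      exact preservesFiniteLimits_op _
    have : PreservesLimitsOfShape J ((FintypeCat.Skeleton.incl ⋙ FintypeCat.incl).op ⋙
        yoneda.obj (d.unop ⟶ c)) := inferInstance
    have := preservesLimitsOfShape_of_natIso (J := J) (powerCoyonedaIso c d.unop).symm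
    exact isLimitOfPreserves (power c ⋙ coyoneda.obj d) hs⟩⟩⟩

/-- The left Kan extension of a representable presheaf is representable. -/
noncomputable def lanYonedaIso {C D : Type u} [SmallCategory C] [SmallCategory D] (g : C ⥤ D)
    (c : C) : g.op.lan.obj (yoneda.obj c) ≅ (yoneda.obj (g.obj c) : Dᵒᵖ ⥤ Type u) where
  hom := ((g.op.lanAdjunction (Type u)).homEquiv _ _).symm (yonedaMap g c)
  inv := yonedaEquiv.symm ((g.op.lanUnit.app (yoneda.obj c)).app (op c) (𝟙 c))
  hom_inv_id := by
    apply ((g.op.lanAdjunction (Type u)).homEquiv _ _).injective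
    apply yonedaEquiv.injective
    rw [← Adjunction.homEquiv_naturality_right_symm, Equiv.apply_symm_apply]
    rw [Adjunction.homEquiv_id, Functor.lanAdjunction_unit]
    simp only [yonedaEquiv, Equiv.coe_fn_mk]
    have h : (yonedaMap g c).app (op c) (𝟙 c) = 𝟙 (g.obj c) := g.map_id c
    change (g.op.lan.obj (yoneda.obj c)).map ((yonedaMap g c).app (op c) (𝟙 c)).op _ = _
    rw [h]
    exact ConcreteCategory.congr_hom ((g.op.lan.obj (yoneda.obj c)).map_id (op (g.obj c))) _
  inv_hom_id := by
    apply yonedaEquiv.injective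
    have h := congr_app ((g.op.lanAdjunction (Type u)).homEquiv_unit (yoneda.obj c) _
      (((g.op.lanAdjunction (Type u)).homEquiv _ _).symm (yonedaMap g c))) (op c)
    rw [Equiv.apply_symm_apply] at h
    have h' := ConcreteCategory.congr_hom h (𝟙 c)
    simp at h'
    simp only [yonedaEquiv, Equiv.coe_fn_mk]
    simp [← h']
    exact g.map_id c

theorem representable_mem (c : C) : freeSyn H C (yoneda.obj c) := by
  have : RepresentablyFlat (power c) := flat_of_preservesFiniteLimits _
  let P : ULift.{u} (Fin 1) → C := fun _ => c
  let e : (power c).obj (op (FintypeCat.Skeleton.mk 1)) ≅ c :=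
    { hom := Pi.π P (ULift.up 0)
      inv := Pi.lift (f := P) fun _ => 𝟙 c
      hom_inv_id := by
        apply limit.hom_ext
        rintro ⟨i⟩
        obtain rfl : i = ULift.up (0 : Fin 1) := Subsingleton.elim (α := ULift (Fin 1)) _ _
        refine (Category.assoc _ _ _).trans ?_
        refine (congrArg (Pi.π P (ULift.up 0) ≫ ·) (Pi.lift_π (f := P) _ _)).trans ?_
        exact (Category.comp_id _).trans (Category.id_comp _).symm
      inv_hom_id := Pi.lift_π (f := P) _ _ }
  exact ⟨pshMap (power c), fun _ _ f _ => PreservesRan.of_adjunction f (pshMapAdj _),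
    ⟨lanYonedaIso (power c) _ ≪≫ yoneda.mapIso e⟩⟩

end Representables

end Logic
open Topos

theorem IsLexLan.congr {C D E : Type*} [Category* C] [Category* D] [Category* E] {P : C ⥤ D}
    {F : C ⥤ E} {L : D ⥤ E} {α α' : F ⟶ P ⋙ L} (h : IsLexLan P F L α)
    (e : ∀ X, α.app X = α'.app X) : IsLexLan P F L α' := by
  obtain rfl : α = α' := by ext X; exact e X
  exact h

section Algebras
variable (H : Logic.{u})

section
variable (C : Type u) [SmallCategory C] [HasFiniteLimits C]

/-- The unit of the doctrine: the Yoneda embedding, corestricted. -/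
noncomputable def unit : C ⥤ T H C :=
  (freeSyn H C).lift yoneda (representable_mem H)

end

/-- A small algebra for the doctrine of `H`: a small left exact category for which the unit has a
left exact left adjoint. -/
structure Alg : Type (u + 1) where
  /-- the underlying category -/
  carrier : Type u
  [cat : SmallCategory carrier]
  [lim : HasFiniteLimits carrier]
  /-- the structure functor -/
  a : T H carrier ⥤ carrier
  lex : PreservesFiniteLimits a
  /-- the structure functor is left adjoint to the unit -/
  adj : a ⊣ unit H carrier

attribute [instance] Alg.cat Alg.lim

variable {H}

/-- A morphism of small algebras: a left exact functor preserving the left Kan extensions in left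
exact categories along the units. -/
structure AlgHom (A B : Alg H) where
  /-- the underlying functor -/
  functor : A.carrier ⥤ B.carrier
  lex : PreservesFiniteLimits functor
  preserves : ∀ (C : Type u) [SmallCategory C] [HasFiniteLimits C] (f : C ⥤ A.carrier)
    [PreservesFiniteLimits f] (L : T H C ⥤ A.carrier) (α : f ⟶ unit H C ⋙ L),
    IsLexLan (unit H C) f L α →
      IsLexLan (unit H C) (f ⋙ functor) (L ⋙ functor)
        (Functor.whiskerRight α functor ≫ (Functor.associator _ _ _).hom)

namespace Alg

instance : CategoryStruct (Alg H) where
  Hom A B := AlgHom A B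
  id A := ⟨𝟭 _, inferInstance, fun C _ _ f _ L α h => IsLexLan.congr
    (F := f ⋙ 𝟭 _) (L := L ⋙ 𝟭 _) (α := α) h fun X => by simp⟩
  comp {A B D} g k := ⟨g.functor ⋙ k.functor,
    have := g.lex; have := k.lex; comp_preservesFiniteLimits _ _,
    fun C _ _ f _ L α h => by
      have := g.lex
      exact IsLexLan.congr (F := f ⋙ g.functor ⋙ k.functor)
        (L := L ⋙ g.functor ⋙ k.functor) (k.preserves C (f ⋙ g.functor) (L ⋙ g.functor) _
        (g.preserves C f L α h)) fun X => by simp⟩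

variable {A B D : Alg H}

/-- A 2-cell between algebra morphisms: a natural transformation. -/
@[ext]
structure Hom₂ (g k : A ⟶ B) where
  /-- the natural transformation -/
  nat : AlgHom.functor g ⟶ AlgHom.functor k

instance : Category (A ⟶ B) where
  Hom g k := Hom₂ g k
  id g := ⟨𝟙 _⟩
  comp α β := ⟨α.nat ≫ β.nat⟩

@[simp] theorem id_functor : AlgHom.functor (𝟙 A) = 𝟭 _ := rfl
@[simp] theorem comp_functor (g : A ⟶ B) (k : B ⟶ D) :
    AlgHom.functor (g ≫ k) = g.functor ⋙ k.functor := rfl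
@[simp] theorem id_nat (g : A ⟶ B) : Hom₂.nat (𝟙 g) = 𝟙 g.functor := rfl
@[simp] theorem comp_nat {f g h : A ⟶ B} (α : f ⟶ g) (β : g ⟶ h) :
    Hom₂.nat (α ≫ β) = α.nat ≫ β.nat := rfl
@[ext] theorem hom₂_ext {f g : A ⟶ B} {α β : f ⟶ g} (h : Hom₂.nat α = Hom₂.nat β) : α = β :=
  Hom₂.ext h

/-- Constructor for 2-cells. -/
@[simps] def mk₂ {f g : A ⟶ B} (η : AlgHom.functor f ⟶ AlgHom.functor g) : f ⟶ g := ⟨η⟩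

/-- Constructor for invertible 2-cells. -/
@[simps] def isoMk {f g : A ⟶ B} (e : AlgHom.functor f ≅ AlgHom.functor g) : f ≅ g where
  hom := ⟨e.hom⟩
  inv := ⟨e.inv⟩

/-- The bicategory of small algebras. -/
@[simps! whiskerLeft_nat whiskerRight_nat associator_hom_nat associator_inv_nat
  leftUnitor_hom_nat leftUnitor_inv_nat rightUnitor_hom_nat rightUnitor_inv_nat]
instance : Bicategory (Alg H) where
  whiskerLeft f g h η := mk₂ (f := f ≫ g) (g := f ≫ h) (Functor.whiskerLeft f.functor (Hom₂.nat η))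
  whiskerRight {_ _ _ f g} η h := mk₂ (f := f ≫ h) (g := g ≫ h)
    (Functor.whiskerRight (Hom₂.nat η) h.functor)
  associator f g h := isoMk (f := (f ≫ g) ≫ h) (g := f ≫ g ≫ h)
    (Functor.associator f.functor g.functor h.functor)
  leftUnitor {A _} f := isoMk (f := 𝟙 A ≫ f) (Functor.leftUnitor f.functor)
  rightUnitor {_ B} f := isoMk (f := f ≫ 𝟙 B) (Functor.rightUnitor f.functor)

/-- The transformation from the inclusion of the doctrine into presheaves to the representables,
given by the unit of the adjunction. -/
def δ (A : Alg H) (X : T H A.carrier) : X.obj ⟶ yoneda.obj (A.a.obj X) := (A.adj.unit.app X).hom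

/-- The least topology whose sheafification inverts all components of `δ`. -/
def topology (A : Alg H) : GrothendieckTopology A.carrier :=
  sInf {J | ∀ X : T H A.carrier, IsIso ((presheafToSheaf J (Type u)).map (A.δ X))}

end Alg

end Algebras
variable {H : Logic.{u}}

section
variable {C : Type u} [SmallCategory C] [HasFiniteLimits C] {E : Type u} [SmallCategory E]

/-- The map out of a representable given by a section of `X : T H C`. -/
noncomputable def elt {c : C} {X : T H C} (s : X.obj.obj (op c)) : (unit H C).obj c ⟶ X :=
  ObjectProperty.homMk (yonedaEquiv.symm s)

theorem elt_map {c : C} {X : T H C} (s : X.obj.obj (op c)) {c' : C} (m : c' ⟶ c) :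
    elt (X := X) (X.obj.map m.op s) = (unit H C).map m ≫ elt s := by
  ext : 1
  exact (yonedaEquiv_symm_map m.op s)

theorem elt_comp {c : C} {X Y : T H C} (s : X.obj.obj (op c)) (m : X ⟶ Y) :
    elt s ≫ m = elt (m.hom.app _ s) := by
  ext : 1
  change yonedaEquiv.symm s ≫ m.hom = yonedaEquiv.symm _
  rw [Equiv.eq_symm_apply, yonedaEquiv_comp, Equiv.apply_symm_apply]

theorem elt_self (c : C) : elt (X := (unit H C).obj c) (𝟙 c) = 𝟙 _ := by
  ext : 1
  change yonedaEquiv.symm _ = 𝟙 (yoneda.obj c)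
  rw [Equiv.symm_apply_eq]
  rfl

variable {f : C ⥤ E} {L : T H C ⥤ E}

/-- A family of weighted cocones presenting each `L X` as the colimit of `f` weighted by `X`. -/
structure Weighted (f : C ⥤ E) (L : T H C ⥤ E) where
  /-- the cocones -/
  τ : ∀ X : T H C, X.obj ⟶ f.op ⋙ yoneda.obj (L.obj X)
  nat : ∀ ⦃X Y : T H C⦄ (m : X ⟶ Y),
    m.hom ≫ τ Y = τ X ≫ Functor.whiskerLeft f.op (yoneda.map (L.map m))
  exists_desc : ∀ (X : T H C) (e : E) (β : X.obj ⟶ f.op ⋙ yoneda.obj e),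
    ∃ γ : L.obj X ⟶ e, τ X ≫ Functor.whiskerLeft f.op (yoneda.map γ) = β
  hom_ext : ∀ (X : T H C) (e : E) (γ γ' : L.obj X ⟶ e),
    τ X ≫ Functor.whiskerLeft f.op (yoneda.map γ) =
      τ X ≫ Functor.whiskerLeft f.op (yoneda.map γ') → γ = γ'

namespace Weighted

variable (W : Weighted f L)

/-- The components of the cocones. -/
def leg {c : C} {X : T H C} (s : X.obj.obj (op c)) : f.obj c ⟶ L.obj X := (W.τ X).app (op c) s

theorem leg_map {c c' : C} {X : T H C} (s : X.obj.obj (op c)) (m : c' ⟶ c) :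
    W.leg (X := X) (X.obj.map m.op s) = f.map m ≫ W.leg s :=
  ConcreteCategory.congr_hom ((W.τ X).naturality m.op) s

theorem leg_comp {c : C} {X Y : T H C} (s : X.obj.obj (op c)) (m : X ⟶ Y) :
    W.leg s ≫ L.map m = W.leg (m.hom.app _ s) :=
  (ConcreteCategory.congr_hom (congr_app (W.nat m) (op c)) s).symm

theorem ext_leg {X : T H C} {e : E} {γ γ' : L.obj X ⟶ e}
    (h : ∀ (c : C) (s : X.obj.obj (op c)), W.leg s ≫ γ = W.leg s ≫ γ') : γ = γ' := by
  apply W.hom_ext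
  ext c s
  exact h c.unop s

/-- The induced transformation. -/
noncomputable def α : f ⟶ unit H C ⋙ L where
  app c := W.leg (X := (unit H C).obj c) (𝟙 c)
  naturality c d m := by
    refine (W.leg_map (X := (unit H C).obj d) (𝟙 d) m).symm.trans ?_
    refine Eq.trans ?_ (W.leg_comp (X := (unit H C).obj c) (𝟙 c) ((unit H C).map m)).symm
    congr 1
    change m ≫ 𝟙 d = 𝟙 c ≫ m
    simp

theorem leg_eq {c : C} {X : T H C} (s : X.obj.obj (op c)) :
    W.leg s = W.α.app c ≫ L.map (elt s) := by
  refine Eq.trans ?_ (W.leg_comp (X := (unit H C).obj c) (𝟙 c) (elt s)).symm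
  congr 1
  exact (yonedaEquiv.apply_symm_apply s).symm

theorem isLexLan (hL : PreservesFiniteLimits L) : IsLexLan (unit H C) f L W.α := by
  refine ⟨hL, fun K _ β => ?_⟩
  have hβ : ∀ {c : C} {X : T H C} (s : X.obj.obj (op c)) {c' : C} (m : c' ⟶ c),
      β.app c' ≫ K.map (elt (X := X) (X.obj.map m.op s)) = f.map m ≫ β.app c ≫ K.map (elt s) := by
    intro c X s c' m
    rw [elt_map, K.map_comp, ← Category.assoc, ← Category.assoc, β.naturality]
    rfl
  choose γ hγ using fun X : T H C => W.exists_desc X (K.obj X)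
    { app := fun c => ↾fun s => β.app c.unop ≫ K.map (elt s)
      naturality := fun c d m => by
        ext s
        exact hβ s m.unop }
  have hγ' : ∀ {c : C} {X : T H C} (s : X.obj.obj (op c)),
      W.leg s ≫ γ X = β.app c ≫ K.map (elt s) := fun {c X} s =>
    ConcreteCategory.congr_hom (congr_app (hγ X) (op c)) s
  refine ⟨{ app := γ, naturality := fun X Y m => W.ext_leg fun c s => ?_ }, ?_, ?_⟩
  · rw [← Category.assoc, W.leg_comp, hγ', ← Category.assoc, hγ', Category.assoc, ← K.map_comp,
      elt_comp]
  · ext c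
    refine (hγ' (X := (unit H C).obj c) (𝟙 c)).trans ?_
    rw [elt_self, K.map_id]
    exact Category.comp_id _
  · intro γ' h
    ext X
    refine W.ext_leg fun c s => ?_
    rw [hγ', leg_eq, Category.assoc, γ'.naturality, ← Category.assoc]
    exact congrArg (· ≫ K.map (elt s)) (congr_app h c)

end Weighted

end

section

variable {C D : Type u} [SmallCategory C] [SmallCategory D] [HasFiniteLimits C]
  [HasFiniteLimits D] (g : C ⥤ D) [PreservesFiniteLimits g]

theorem lan_mem (X : T H C) : freeSyn H D (g.op.lan.obj X.obj) := by
  have : RepresentablyFlat g := flat_of_preservesFiniteLimits g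
  obtain ⟨p, hp, ⟨e⟩⟩ := X.property
  exact ⟨pshMap g ≫ p, (WRInj H).comp_mem _ _
    (fun _ _ f _ => PreservesRan.of_adjunction f (pshMapAdj g)) hp, ⟨g.op.lan.mapIso e⟩⟩

/-- The doctrine on left exact functors: left Kan extension of presheaves. -/
noncomputable def T.map : T H C ⥤ T H D :=
  (freeSyn H D).lift ((freeSyn H C).ι ⋙ g.op.lan) (lan_mem g)

instance : PreservesFiniteLimits ((freeSyn H C).ι) where
  preservesFiniteLimits J _ _ := by
    apply preservesLimitsOfShape_of_evaluation
    intro c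
    refine preservesLimitsOfShape_of_natIso
      (F := coyoneda.obj (op ((unit H C).obj c.unop))) ?_
    refine NatIso.ofComponents (fun X =>
      ((freeSyn H C).fullyFaithfulι.homEquiv.trans yonedaEquiv).toIso) ?_
    intro X Y m
    ext φ
    exact yonedaEquiv_comp _ _

instance : PreservesFiniteLimits (T.map (H := H) g) := by
  have : PreservesFiniteLimits (T.map (H := H) g ⋙ (freeSyn H D).ι) := by
    change PreservesFiniteLimits ((freeSyn H C).ι ⋙ g.op.lan)
    have := lan_preservesFiniteLimits_of_preservesFiniteLimits (Type u) g
    exact comp_preservesFiniteLimits _ _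
  exact ⟨fun J _ _ => preservesLimitsOfShape_of_reflects_of_preserves _ (freeSyn H D).ι⟩

end

namespace Alg

theorem δ_naturality (A : Alg H) {X Y : T H A.carrier} (m : X ⟶ Y) :
    m.hom ≫ A.δ Y = A.δ X ≫ yoneda.map (A.a.map m) :=
  (freeSyn H A.carrier).ι.congr_map (A.adj.unit.naturality m)

theorem exists_desc (A : Alg H) {X : T H A.carrier} {c : A.carrier} (β : X.obj ⟶ yoneda.obj c) :
    ∃ γ : A.a.obj X ⟶ c, A.δ X ≫ yoneda.map γ = β := by
  refine ⟨(A.adj.homEquiv X c).symm (ObjectProperty.homMk β), ?_⟩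
  have := A.adj.homEquiv_unit X c ((A.adj.homEquiv X c).symm (ObjectProperty.homMk β))
  rw [Equiv.apply_symm_apply] at this
  exact ((freeSyn H A.carrier).ι.congr_map this).symm

theorem hom_ext (A : Alg H) {X : T H A.carrier} {c : A.carrier} {γ γ' : A.a.obj X ⟶ c}
    (h : A.δ X ≫ yoneda.map γ = A.δ X ≫ yoneda.map γ') : γ = γ' := by
  apply (A.adj.homEquiv X c).injective
  rw [A.adj.homEquiv_unit, A.adj.homEquiv_unit]
  exact (freeSyn H A.carrier).ι.map_injective h

/-- The structure functor as a weighted colimit. -/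
noncomputable def weighted (A : Alg H) : Weighted (𝟭 A.carrier) A.a where
  τ X := A.δ X
  nat _ _ m := A.δ_naturality m
  exists_desc _ _ β := A.exists_desc β
  hom_ext _ _ _ _ h := A.hom_ext h

/-- The composite of the doctrine on `g` and the structure functor as a weighted colimit. -/
noncomputable def weightedMap (B : Alg H) {C : Type u} [SmallCategory C] [HasFiniteLimits C]
    (g : C ⥤ B.carrier) [PreservesFiniteLimits g] : Weighted g (T.map (H := H) g ⋙ B.a) where
  τ X := (g.op.lanAdjunction (Type u)).homEquiv _ _ (B.δ ((T.map g).obj X))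
  nat X Y m := by
    refine (Adjunction.homEquiv_naturality_left (g.op.lanAdjunction (Type u)) m.hom
      (B.δ ((T.map g).obj Y))).symm.trans ?_
    exact (congrArg _ (B.δ_naturality ((T.map g).map m))).trans
      (Adjunction.homEquiv_naturality_right _ _ _)
  exists_desc X e β := by
    obtain ⟨γ, hγ⟩ := B.exists_desc (X := (T.map g).obj X)
      (((g.op.lanAdjunction (Type u)).homEquiv _ _).symm β)
    refine ⟨γ, ?_⟩
    refine (Adjunction.homEquiv_naturality_right (g.op.lanAdjunction (Type u))
      (B.δ ((T.map g).obj X)) (yoneda.map γ)).symm.trans ?_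
    exact (Equiv.eq_symm_apply ((g.op.lanAdjunction (Type u)).homEquiv X.obj _)).1 hγ
  hom_ext X e γ γ' h := by
    apply B.hom_ext (X := (T.map g).obj X)
    apply ((g.op.lanAdjunction (Type u)).homEquiv _ _).injective
    exact (Adjunction.homEquiv_naturality_right _ _ _).trans
      (h.trans (Adjunction.homEquiv_naturality_right _ _ _).symm)

section

variable {A B : Alg H} (g : A ⟶ B)

instance : PreservesFiniteLimits (AlgHom.functor g) := AlgHom.lex g

/-- The transpose of the image of `δ` under `g`. -/
noncomputable def ψ (X : T H A.carrier) :
    g.functor.op.lan.obj X.obj ⟶ yoneda.obj (g.functor.obj (A.a.obj X)) :=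
  ((g.functor.op.lanAdjunction (Type u)).homEquiv _ _).symm
    (A.δ X ≫ yonedaMap g.functor (A.a.obj X))

theorem exists_iso : ∃ e : A.a ⋙ g.functor ≅ T.map g.functor ⋙ B.a,
    ∀ X, ψ g X ≫ yoneda.map (e.hom.app X) = B.δ ((T.map g.functor).obj X) := by
  have h₁ := AlgHom.preserves g A.carrier (𝟭 _) A.a _ (A.weighted.isLexLan A.lex)
  have : PreservesFiniteLimits B.a := B.lex
  have h₂ := (B.weightedMap g.functor).isLexLan (comp_preservesFiniteLimits _ _)
  obtain ⟨e, he, -⟩ := h₁.2 _ h₂.1 (B.weightedMap g.functor).α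
  obtain ⟨e', he', -⟩ := h₂.2 _ h₁.1 (Functor.whiskerRight A.weighted.α g.functor ≫
    (Functor.associator _ _ _).hom)
  refine ⟨⟨e, e', ?_, ?_⟩, ?_⟩
  · refine (h₁.2 _ h₁.1 _).unique ?_ (Category.comp_id _)
    rw [Functor.whiskerLeft_comp, ← Category.assoc]
    exact (congrArg (· ≫ _) he).trans he'
  · refine (h₂.2 _ h₂.1 _).unique ?_ (Category.comp_id _)
    rw [Functor.whiskerLeft_comp, ← Category.assoc]
    exact (congrArg (· ≫ _) he').trans he
  · intro X
    apply ((g.functor.op.lanAdjunction (Type u)).homEquiv _ _).injective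
    refine (Adjunction.homEquiv_naturality_right _ _ _).trans ?_
    rw [ψ, Equiv.apply_symm_apply]
    ext c s
    have h := congr_app he c.unop
    refine Eq.trans ?_ ((B.weightedMap g.functor).leg_eq (X := X) s).symm
    rw [← h]
    change g.functor.map (A.weighted.leg s) ≫ e.app X = _
    rw [A.weighted.leg_eq]
    rw [g.functor.map_comp, Category.assoc]
    refine (congrArg (_ ≫ ·) (e.naturality (elt s))).trans ?_
    rw [← Category.assoc]
    refine congrArg (· ≫ (T.map g.functor ⋙ B.a).map (elt s)) ?_
    exact congrArg (· ≫ e.app _) (Category.comp_id _).symm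

end

end Alg

section

variable {C D : Type u} [SmallCategory C] [SmallCategory D] [HasFiniteLimits C]
  (g : C ⥤ D) [PreservesFiniteLimits g]

theorem exists_lift {V W Z : C} (f₁ : V ⟶ Z) (f₂ : W ⟶ Z) {U : D} (φ : U ⟶ g.obj V)
    (k : U ⟶ g.obj W) (h : φ ≫ g.map f₁ = k ≫ g.map f₂) :
    ∃ l : U ⟶ g.obj (pullback f₁ f₂), l ≫ g.map (pullback.fst f₁ f₂) = φ ∧
      l ≫ g.map (pullback.snd f₁ f₂) = k :=
  ⟨(isLimitOfHasPullbackOfPreservesLimit g f₁ f₂).lift (PullbackCone.mk φ k h),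
    (isLimitOfHasPullbackOfPreservesLimit g f₁ f₂).fac (PullbackCone.mk φ k h) .left,
    (isLimitOfHasPullbackOfPreservesLimit g f₁ f₂).fac (PullbackCone.mk φ k h) .right⟩

/-- The topology of all sieves whose image under `g` is covering. -/
def comapTopology (K : GrothendieckTopology D) : GrothendieckTopology C where
  sieves c := {S | S.functorPushforward g ∈ K (g.obj c)}
  top_mem' c := by
    rw [Set.mem_ofPred, Sieve.functorPushforward_top]
    exact K.top_mem _
  pullback_stable' c c' S f hS := by
    refine K.superset_covering ?_ (K.pullback_stable (g.map f) hS)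
    rintro U k ⟨V, m, φ, hm, h⟩
    obtain ⟨l, -, h₂⟩ := exists_lift g m f φ k h.symm
    refine ⟨_, pullback.snd m f, l, ?_, h₂.symm⟩
    change S _
    rw [← pullback.condition]
    exact S.downward_closed hm _
  transitive' c S hS R h := by
    refine K.transitive hS _ ?_
    rintro U k ⟨V, m, φ, hm, rfl⟩
    rw [Sieve.pullback_comp]
    refine K.pullback_stable φ (K.superset_covering ?_ (h hm))
    rintro U' k' ⟨V', m', φ', hm', rfl⟩
    exact ⟨V', m' ≫ m, φ', hm', by simp⟩

variable (X : Cᵒᵖ ⥤ Type u)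

theorem lan_exists {U : D} (t : (g.op.lan.obj X).obj (op U)) :
    ∃ (V : C) (φ : U ⟶ g.obj V) (s : X.obj (op V)),
      (g.op.lan.obj X).map φ.op ((g.op.lanUnit.app X).app (op V) s) = t := by
  obtain ⟨j, s, rfl⟩ := Types.jointly_surjective_of_isColimit
    (g.op.isPointwiseLeftKanExtensionLeftKanExtensionUnit X (op U)) t
  exact ⟨j.left.unop, j.hom.unop, s, rfl⟩

theorem lan_eq {U : D} {V : C} (φ : U ⟶ g.obj V) (s s' : X.obj (op V))
    (h : (g.op.lan.obj X).map φ.op ((g.op.lanUnit.app X).app (op V) s) =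
      (g.op.lan.obj X).map φ.op ((g.op.lanUnit.app X).app (op V) s')) :
    ∃ (V' : C) (m : V' ⟶ V) (φ' : U ⟶ g.obj V'), φ' ≫ g.map m = φ ∧
      X.map m.op s = X.map m.op s' := by
  have : RepresentablyFlat g := flat_of_preservesFiniteLimits g
  have : IsCofiltered (StructuredArrow U g) := RepresentablyFlat.cofiltered U
  have : IsFiltered (CostructuredArrow g.op (op U)) :=
    IsFiltered.of_equivalence (structuredArrowOpEquivalence g U)
  obtain ⟨j, f, hf⟩ := (Types.FilteredColimit.isColimit_eq_iff'
    (g.op.isPointwiseLeftKanExtensionLeftKanExtensionUnit X (op U))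
    (i := CostructuredArrow.mk (Y := op V) φ.op) s s').1 h
  refine ⟨j.left.unop, f.left.unop, j.hom.unop, ?_, hf⟩
  exact congrArg Quiver.Hom.unop (CostructuredArrow.w f)

end

namespace Alg

theorem isLocallyBijective_δ (A : Alg H) (X : T H A.carrier) :
    Presheaf.IsLocallyInjective A.topology (A.δ X) ∧
      Presheaf.IsLocallySurjective A.topology (A.δ X) := by
  refine ⟨⟨fun x y h => ?_⟩, ⟨fun s => ?_⟩⟩ <;>
  · refine (GrothendieckTopology.mem_sInf _ _).2 fun J hJ => ?_
    have := (J.W_iff_isLocallyBijective (A.δ X)).1 ((J.W_iff (A := Type u) _).2 (hJ X))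
    first
    | exact this.1.equalizerSieve_mem x y h
    | exact this.2.imageSieve_mem s

theorem topology_le (A : Alg H) (J : GrothendieckTopology A.carrier)
    (h : ∀ X, Presheaf.IsLocallyInjective J (A.δ X) ∧
      Presheaf.IsLocallySurjective J (A.δ X)) : A.topology ≤ J :=
  (GrothendieckTopology.isGLB_sInf _).1 fun X =>
    (J.W_iff (A := Type u) _).1 ((J.W_iff_isLocallyBijective (A.δ X)).2 (h X))

variable {A B : Alg H} (g : A ⟶ B)

theorem isLocallyBijective_ψ (X : T H A.carrier) :
    Presheaf.IsLocallyInjective B.topology (ψ g X) ∧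
      Presheaf.IsLocallySurjective B.topology (ψ g X) := by
  obtain ⟨e, he⟩ := exists_iso g
  have h := (B.topology.W_iff (A := Type u) _).1 ((B.topology.W_iff_isLocallyBijective _).2
    (B.isLocallyBijective_δ ((T.map g.functor).obj X)))
  refine (B.topology.W_iff_isLocallyBijective _).1 ((B.topology.W_iff (A := Type u) _).2 ?_)
  have h' : IsIso ((presheafToSheaf B.topology (Type u)).map
      (ψ g X ≫ yoneda.map (e.hom.app X))) := by
    rw [he]
    exact h
  rw [Functor.map_comp] at h'
  exact IsIso.of_isIso_comp_right _ ((presheafToSheaf B.topology (Type u)).map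
    (yoneda.map (e.hom.app X)))

theorem ψ_unit (X : T H A.carrier) {V : A.carrier} (s : X.obj.obj (op V)) :
    (ψ g X).app _ ((g.functor.op.lanUnit.app X.obj).app (op V) s) =
      g.functor.map ((A.δ X).app _ s) := by
  have h := (g.functor.op.lanAdjunction (Type u)).homEquiv_unit _ _ (ψ g X)
  rw [Functor.lanAdjunction_unit, ψ, Equiv.apply_symm_apply] at h
  exact (ConcreteCategory.congr_hom (congr_app h (op V)) s).symm

theorem ψ_unit_map (X : T H A.carrier) {U : B.carrier} {V : A.carrier}
    (φ : U ⟶ g.functor.obj V) (s : X.obj.obj (op V)) :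
    (ψ g X).app _ ((g.functor.op.lan.obj X.obj).map φ.op
        ((g.functor.op.lanUnit.app X.obj).app (op V) s)) =
      φ ≫ g.functor.map ((A.δ X).app _ s) := by
  rw [← ψ_unit]
  exact ConcreteCategory.congr_hom ((ψ g X).naturality φ.op)
    ((g.functor.op.lanUnit.app X.obj).app (op V) s)

theorem topology_le_comap : A.topology ≤ comapTopology g.functor B.topology := by
  refine A.topology_le _ fun X => ?_
  obtain ⟨h₁, h₂⟩ := isLocallyBijective_ψ g X
  refine ⟨⟨fun {W} x y h => ?_⟩, ⟨fun {W} m => ?_⟩⟩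
  · have hx : (ψ g X).app _ ((g.functor.op.lanUnit.app X.obj).app W x) =
        (ψ g X).app _ ((g.functor.op.lanUnit.app X.obj).app W y) :=
      (ψ_unit g X (V := W.unop) x).trans
        ((congrArg g.functor.map h).trans (ψ_unit g X (V := W.unop) y).symm)
    refine B.topology.superset_covering ?_ (h₁.equalizerSieve_mem _ _ hx)
    intro U k hk
    obtain ⟨V', n, φ', hn, hs⟩ := lan_eq g.functor X.obj (V := W.unop) k x y hk
    exact ⟨V', n, φ', hs, hn.symm⟩
  · refine B.topology.superset_covering ?_ (h₂.imageSieve_mem (g.functor.map m))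
    rintro U k ⟨t, ht⟩
    obtain ⟨V, φ, s, rfl⟩ := lan_exists g.functor X.obj t
    obtain ⟨p, hp⟩ : ∃ p : V ⟶ A.a.obj X, (A.δ X).app (op V) s = p := ⟨_, rfl⟩
    have hφ := ψ_unit_map g X φ s
    rw [hp] at hφ
    obtain ⟨l, -, hl⟩ := exists_lift g.functor p m φ k (hφ.symm.trans ht)
    refine ⟨_, pullback.snd p m, l, ⟨X.obj.map (pullback.fst p m).op s, ?_⟩, hl.symm⟩
    refine (ConcreteCategory.congr_hom ((A.δ X).naturality (pullback.fst p m).op) s).trans ?_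
    refine (congrArg (pullback.fst p m ≫ ·) hp).trans ?_
    exact pullback.condition

instance : RepresentablyFlat (AlgHom.functor g) :=
  have := AlgHom.lex g
  flat_of_preservesFiniteLimits _

instance isContinuous : (AlgHom.functor g).IsContinuous A.topology B.topology :=
  Functor.isContinuous_of_coverPreserving (compatiblePreservingOfFlat _ _)
    ⟨fun hS => topology_le_comap g _ hS⟩

end Alg

/-- The classifying topos of a small algebra: sheaves for the least topology inverting `δ`. -/
def Cl.obj (A : Alg H) : Topos.{u} := sh A.topology

/-- The inclusion of the classifying topos into the free topos. -/
noncomputable def Cl.incl (A : Alg H) : Cl.obj A ⟶ psh A.carrier := shIncl A.topology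

/-- The geometric morphism induced by a morphism of algebras; its direct image is precomposition. -/
noncomputable def Cl.map {A B : Alg H} (g : A ⟶ B) : Cl.obj B ⟶ Cl.obj A where
  direct := (AlgHom.functor g).sheafPushforwardContinuous (Type u) A.topology B.topology
  inverse := (AlgHom.functor g).sheafPullback (Type u) A.topology B.topology
  adj := (AlgHom.functor g).sheafAdjunctionContinuous (Type u) A.topology B.topology
  lex := by
    have : PreservesFiniteLimits ((AlgHom.functor g).op.lan : _ ⥤ _ ⥤ Type u) :=
      lan_preservesFiniteLimits_of_flat (Type u) _
    exact Functor.sheafPullbackConstruction.preservesFiniteLimits _ _ _ _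

theorem Cl.direct_obj {A B : Alg H} (g : A ⟶ B) (F : Sheaf B.topology (Type u)) :
    ((Cl.map g).direct.obj F).obj = (AlgHom.functor g).op ⋙ F.obj := rfl

/-- The 2-cell induced by a 2-cell of algebra morphisms, with mate given by restriction. -/
noncomputable def Cl.map₂ {A B : Alg H} {g k : A ⟶ B} (η : g ⟶ k) : Cl.map g ⟶ Cl.map k :=
  ofMate (f := Cl.map g) (g := Cl.map k)
    (Functor.sheafPushforwardContinuousNatTrans (Alg.Hom₂.nat η) (Type u) A.topology B.topology)

/-- Compatibility with identities. -/
noncomputable def Cl.mapId (A : Alg H) : Cl.map (𝟙 A) ≅ 𝟙 (Cl.obj A) :=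
  isoOfMate (f := Cl.map (𝟙 A)) (g := 𝟙 (Cl.obj A))
    (Functor.sheafPushforwardContinuousId (Type u) A.topology).symm

/-- Compatibility with composition. -/
noncomputable def Cl.mapComp {A B D : Alg H} (g : A ⟶ B) (k : B ⟶ D) :
    Cl.map (g ≫ k) ≅ Cl.map k ≫ Cl.map g :=
  isoOfMate (f := Cl.map (g ≫ k)) (g := Cl.map k ≫ Cl.map g)
    (Functor.sheafPushforwardContinuousComp (AlgHom.functor g) (AlgHom.functor k) (Type u)
      A.topology B.topology D.topology)

namespace Cl

section

variable {A B D E : Alg H}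

@[simp] theorem mate_map₂ {g k : A ⟶ B} (η : g ⟶ k) : mate (Cl.map₂ η) =
    Functor.sheafPushforwardContinuousNatTrans (Alg.Hom₂.nat η) (Type u) A.topology B.topology :=
  mate_ofMate _

@[simp] theorem mate_mapId_hom : mate (Cl.mapId A).hom =
    (Functor.sheafPushforwardContinuousId (Type u) A.topology).inv := mate_ofMate _

@[simp] theorem mate_mapComp_hom (g : A ⟶ B) (k : B ⟶ D) : mate (Cl.mapComp g k).hom =
    (Functor.sheafPushforwardContinuousComp (AlgHom.functor g) (AlgHom.functor k) (Type u)
      A.topology B.topology D.topology).hom := mate_ofMate _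

@[simp] theorem mate_mapComp_inv (g : A ⟶ B) (k : B ⟶ D) : mate (Cl.mapComp g k).inv =
    (Functor.sheafPushforwardContinuousComp (AlgHom.functor g) (AlgHom.functor k) (Type u)
      A.topology B.topology D.topology).inv := mate_ofMate _

theorem map₂_id (g : A ⟶ B) : Cl.map₂ (𝟙 g) = 𝟙 (Cl.map g) := by
  apply mate_injective
  rw [mate_map₂, mate_id]
  ext F : 2
  apply Sheaf.hom_ext
  ext c x
  exact ConcreteCategory.congr_hom (F.obj.map_id _) x

theorem map₂_comp {g k l : A ⟶ B} (η : g ⟶ k) (θ : k ⟶ l) :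
    Cl.map₂ (η ≫ θ) = Cl.map₂ η ≫ Cl.map₂ θ := by
  apply mate_injective
  rw [mate_comp, mate_map₂, mate_map₂, mate_map₂]
  ext F : 2
  apply Sheaf.hom_ext
  ext c x
  exact ConcreteCategory.congr_hom (F.obj.map_comp (((Alg.Hom₂.nat θ).app c.unop).op)
    (((Alg.Hom₂.nat η).app c.unop).op)) x

theorem map₂_whisker_left (f : A ⟶ B) {g h : B ⟶ D} (η : g ⟶ h) : Cl.map₂ (f ◁ η) =
    (Cl.mapComp f g).hom ≫ (Cl.map₂ η ▷ Cl.map f) ≫ (Cl.mapComp f h).inv := by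
  apply mate_injective
  rw [mate_comp, mate_comp, mate_map₂, mate_whiskerRight, mate_map₂, mate_mapComp_hom,
    mate_mapComp_inv]
  ext F : 2
  apply Sheaf.hom_ext
  ext c x
  rfl

theorem map₂_whisker_right {f g : A ⟶ B} (η : f ⟶ g) (h : B ⟶ D) : Cl.map₂ (η ▷ h) =
    (Cl.mapComp f h).hom ≫ (Cl.map h ◁ Cl.map₂ η) ≫ (Cl.mapComp g h).inv := by
  apply mate_injective
  rw [mate_comp, mate_comp, mate_map₂, mate_whiskerLeft, mate_map₂, mate_mapComp_hom,
    mate_mapComp_inv]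
  ext F : 2
  apply Sheaf.hom_ext
  ext c x
  rfl

theorem map₂_associator (f : A ⟶ B) (g : B ⟶ D) (h : D ⟶ E) : Cl.map₂ (α_ f g h).hom =
    (Cl.mapComp (f ≫ g) h).hom ≫ (Cl.map h ◁ (Cl.mapComp f g).hom) ≫
      (α_ (Cl.map h) (Cl.map g) (Cl.map f)).inv ≫ ((Cl.mapComp g h).inv ▷ Cl.map f) ≫
        (Cl.mapComp f (g ≫ h)).inv := by
  apply mate_injective
  rw [mate_comp, mate_comp, mate_comp, mate_comp, mate_map₂, mate_whiskerLeft, mate_whiskerRight,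
    mate_associator_inv, mate_mapComp_hom, mate_mapComp_hom, mate_mapComp_inv, mate_mapComp_inv]
  ext F : 2
  apply Sheaf.hom_ext
  ext c x
  exact ConcreteCategory.congr_hom (F.obj.map_id _) x

theorem map₂_left_unitor (f : A ⟶ B) : Cl.map₂ (λ_ f).hom =
    (Cl.mapComp (𝟙 A) f).hom ≫ (Cl.map f ◁ (Cl.mapId A).hom) ≫ (ρ_ (Cl.map f)).hom := by
  apply mate_injective
  rw [mate_comp, mate_comp, mate_map₂, mate_whiskerLeft, mate_rightUnitor_hom, mate_mapComp_hom,
    mate_mapId_hom]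
  ext F : 2
  apply Sheaf.hom_ext
  ext c x
  exact ConcreteCategory.congr_hom (F.obj.map_id _) x

theorem map₂_right_unitor (f : A ⟶ B) : Cl.map₂ (ρ_ f).hom =
    (Cl.mapComp f (𝟙 B)).hom ≫ ((Cl.mapId B).hom ▷ Cl.map f) ≫ (λ_ (Cl.map f)).hom := by
  apply mate_injective
  rw [mate_comp, mate_comp, mate_map₂, mate_whiskerRight, mate_leftUnitor_hom, mate_mapComp_hom,
    mate_mapId_hom]
  ext F : 2
  apply Sheaf.hom_ext
  ext c x
  exact ConcreteCategory.congr_hom (F.obj.map_id _) x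

end

end Cl

open Bicategory.Opposite in
/-- The classifying topos pseudofunctor. -/
noncomputable def Cl (H : Logic.{u}) : Alg H ⥤ᵖ Topos.{u}ᵒᵖ where
  obj A := op (Cl.obj A)
  map g := (Cl.map g).op
  map₂ η := op2 (Cl.map₂ η)
  mapId A := (Cl.mapId A).op2
  mapComp g k := (Cl.mapComp g k).op2
  map₂_id g := congrArg op2 (Cl.map₂_id g)
  map₂_comp η θ := congrArg op2 (Cl.map₂_comp η θ)
  map₂_whisker_left f _ _ η := congrArg op2 (Cl.map₂_whisker_left f η)
  map₂_whisker_right η h := congrArg op2 (Cl.map₂_whisker_right η h)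
  map₂_associator f g h := congrArg op2 (Cl.map₂_associator f g h)
  map₂_left_unitor f := congrArg op2 (Cl.map₂_left_unitor f)
  map₂_right_unitor f := congrArg op2 (Cl.map₂_right_unitor f)

end KanLogic

/-! Everything rests on a description of right Kan extensions into a free topos. A 2-cell `κ : f ≫ r
⟶ p` transposes to a map `r^* ⟶ f_* p^*` (`transpose`). Since `r^*` is cocontinuous and every
presheaf is a colimit of representables, maps out of `r^*` are determined freely on representables.
So `κ` is a right Kan extension as soon as its transpose is invertible there
(`isRan_of_isIso_transpose`). Such an `r` exists by Diaconescu's theorem, because `f_* p^*`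
restricted to `C` is left exact (`exists_isRan_psh`). By uniqueness every right Kan extension into
`psh C` has this form. It is also pointwise, since `(r_* A)(c)` is then the set of maps `f_* p^* (y
c) ⟶ A`.

For a presheaf `X` in `T H C`, classified by a 1-cell `q` of `WRInj H`, the composite `r ≫ q` is
again a right Kan extension into a presheaf topos, so its transpose is invertible at the generic
object. Hence the transpose of `κ` is invertible at `X` too (`isIso_transpose_of_mem_freeSyn`).

Now let `p` land in the classifying topos of an algebra `A`, and extend its composite with the
inclusion to `r : F ⟶ psh A`. The inverse image of that composite inverts each `δ_X`. The transpose
is invertible at both ends of `δ_X`, so by naturality `r^*` inverts `δ_X` as well. A geometric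
morphism whose inverse image inverts every `δ_X` factors through the classifying topos
(`Cl.exists_factor_incl`). An embedding reflects right Kan extensions and their pointwiseness, so
the factorisation is the required extension, the inclusion preserves it, and it is pointwise.

For a morphism `g` of algebras, `Cl.map g` followed by the inclusion is the inclusion followed by
`pshMap g`. The latter is a right adjoint in topoi, so the composite preserves right Kan extensions,
and the embedding reflects this to `Cl.map g`. -/

namespace KanLogic

/-! ### Diaconescu's theorem for left exact functors. -/

section Diaconescu

variable {C : Type u} [SmallCategory C] [HasFiniteLimits C]

/-- The category of elements of a left exact `A` is cofiltered, so `A` is the fiber of a point of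
the trivial topology. The presheaf fiber of that point is left exact by exactness of filtered
colimits of sets. It agrees with `L` because both are left Kan extensions of `A` along Yoneda. -/
theorem preservesFiniteLimits_yonedaExtension_type (A : C ⥤ Type u) [PreservesFiniteLimits A]
    (L : (Cᵒᵖ ⥤ Type u) ⥤ Type u) [PreservesColimitsOfSize.{u, u} L]
    (e : A ≅ uliftYoneda.{u} ⋙ L) : PreservesFiniteLimits L := by
  have : IsCofiltered A.Elements := A.isCofiltered_elements
  have : InitiallySmall.{u} A.Elements := initiallySmall_of_essentiallySmall _
  let Φ : GrothendieckTopology.Point.{u} (⊥ : GrothendieckTopology C) :=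
    { fiber := A
      -- Only maximal sieves cover for the trivial topology, so the identity arrow suffices.
      jointly_surjective := fun R hR x => by
        obtain rfl : R = ⊤ := by simpa using hR
        exact ⟨_, 𝟙 _, by simp, x, by simp⟩ }
  let e' : A ≅ uliftYoneda.{u} ⋙ Φ.presheafFiber (A := Type u) :=
    Φ.shrinkYonedaCompPresheafFiberIso.symm ≪≫
      Functor.isoWhiskerRight (shrinkYonedaIsoYoneda ≪≫ uliftYonedaIsoYoneda.symm) _
  have : AB5OfSize.{u, u} (Type u) := inferInstanceAs (AB5 (Type u))
  have : PreservesFiniteLimits (Φ.presheafFiber (A := Type u)) := inferInstance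
  have : uliftYoneda.{u}.HasPointwiseLeftKanExtension A := inferInstance
  have h₁ := Presheaf.isLeftKanExtension_of_preservesColimits.{u} Φ.presheafFiber e'
  have h₂ := Presheaf.isLeftKanExtension_of_preservesColimits.{u} L e
  exact preservesFiniteLimits_of_natIso (Functor.leftKanExtensionUnique _ e'.hom _ e.hom)

/-- Limits of presheaves are computed objectwise, which reduces the claim to set-valued functors. -/
theorem preservesFiniteLimits_yonedaExtension_presheaf {D : Type u} [SmallCategory D]
    (G : C ⥤ Dᵒᵖ ⥤ Type u) [PreservesFiniteLimits G] (L : (Cᵒᵖ ⥤ Type u) ⥤ Dᵒᵖ ⥤ Type u)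
    [PreservesColimitsOfSize.{u, u} L] (e : G ≅ uliftYoneda.{u} ⋙ L) :
    PreservesFiniteLimits L := by
  refine ⟨fun J _ _ => ?_⟩
  apply preservesLimitsOfShape_of_evaluation
  intro d
  have : PreservesFiniteLimits (G ⋙ (evaluation Dᵒᵖ (Type u)).obj d) :=
    comp_preservesFiniteLimits _ _
  have : PreservesColimitsOfSize.{u, u} (L ⋙ (evaluation Dᵒᵖ (Type u)).obj d) :=
    comp_preservesColimits _ _
  have := preservesFiniteLimits_yonedaExtension_type (G ⋙ (evaluation Dᵒᵖ (Type u)).obj d)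
    (L ⋙ (evaluation Dᵒᵖ (Type u)).obj d)
    (Functor.isoWhiskerRight e _)
  exact this.preservesFiniteLimits J

/-- Diaconescu's theorem for a left exact functor on a small left exact category. -/
theorem Topos.exists_geomMor_of_lex (F : Topos.{u}) (G : C ⥤ F) [PreservesFiniteLimits G] :
    ∃ r : F ⟶ Topos.psh C, Nonempty (yoneda ⋙ GeomMor.inverse r ≅ G) := by
  obtain ⟨D, _, K, ⟨eq⟩⟩ := F.isTopos
  have : HasColimitsOfSize.{u, u} (Sheaf K (Type u)) := Sheaf.instHasColimitsOfSize
  have : HasColimitsOfSize.{u, u} F := Adjunction.has_colimits_of_equivalence eq.functor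
  -- The Yoneda extension is formed in presheaves on a site for `F`, where left exactness is
  -- objectwise, and then brought back by the left exact cocontinuous `R`. The isomorphism `e₀` says
  -- that `R` undoes the embedding of `F` into presheaves.
  let G' : C ⥤ Dᵒᵖ ⥤ Type u := G ⋙ eq.functor ⋙ sheafToPresheaf K (Type u)
  have : PreservesFiniteLimits (sheafToPresheaf K (Type u)) :=
    PreservesLimitsOfSize.preservesFiniteLimits.{0, 0} _
  have : PreservesFiniteLimits (eq.functor ⋙ sheafToPresheaf K (Type u)) :=
    comp_preservesFiniteLimits _ _
  have : PreservesFiniteLimits G' := comp_preservesFiniteLimits _ _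
  let R : (Dᵒᵖ ⥤ Type u) ⥤ F := presheafToSheaf K (Type u) ⋙ eq.inverse
  have : PreservesFiniteLimits (presheafToSheaf K (Type u)) := HasSheafify.isLeftExact
  have : PreservesFiniteLimits R := comp_preservesFiniteLimits _ _
  have : PreservesColimitsOfSize.{u, u} R :=
    ((sheafificationAdjunction K (Type u)).comp
      eq.symm.toAdjunction).leftAdjoint_preservesColimits
  let L' := uliftYoneda.{u}.leftKanExtension G'
  have : PreservesColimitsOfSize.{u, u} L' :=
    Presheaf.preservesColimitsOfSize_leftKanExtension.{u} G'
  have : IsIso (uliftYoneda.{u}.leftKanExtensionUnit G') :=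
    Presheaf.isIso_of_isLeftKanExtension.{u} _ _
  let e' : G' ≅ uliftYoneda.{u} ⋙ L' := asIso (uliftYoneda.{u}.leftKanExtensionUnit G')
  have : PreservesFiniteLimits L' := preservesFiniteLimits_yonedaExtension_presheaf G' L' e'
  let L : (Cᵒᵖ ⥤ Type u) ⥤ F := L' ⋙ R
  have : PreservesFiniteLimits L := comp_preservesFiniteLimits _ _
  have : PreservesColimitsOfSize.{u, u} L := comp_preservesColimits _ _
  let e₀ : (eq.functor ⋙ sheafToPresheaf K (Type u)) ⋙ R ≅ 𝟭 F :=
    Functor.isoWhiskerLeft eq.functor (Functor.isoWhiskerRight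
      (asIso (sheafificationAdjunction K (Type u)).counit) eq.inverse) ≪≫ eq.unitIso.symm
  let e : G ≅ uliftYoneda.{u} ⋙ L :=
    Functor.isoWhiskerLeft G e₀.symm ≪≫ Functor.isoWhiskerRight e' R
  have := Presheaf.isLeftKanExtension_of_preservesColimits.{u} L e
  refine ⟨⟨_, L, Presheaf.uliftYonedaAdjunction.{u} L e.hom, ‹_›⟩, ⟨?_⟩⟩
  exact Functor.isoWhiskerRight uliftYonedaIsoYoneda.{u}.symm L ≪≫ e.symm

end Diaconescu

theorem IsRan.exists_iso {B : Type u} [Bicategory.{w, v} B] {a b x : B} {f : a ⟶ b} {p : a ⟶ x}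
    {r r' : b ⟶ x} {κ : f ≫ r ⟶ p} {κ' : f ≫ r' ⟶ p} (h : IsRan r κ) (h' : IsRan r' κ') :
    ∃ e : r ≅ r', f ◁ e.hom ≫ κ' = κ := by
  obtain ⟨γ, hγ, -⟩ := h' r κ
  obtain ⟨γ', hγ', -⟩ := h r' κ'
  refine ⟨⟨γ, γ', (h r κ).unique ?_ ?_, (h' r' κ').unique ?_ ?_⟩, hγ⟩
  · simp only [whiskerLeft_comp, Category.assoc, hγ', hγ]
  · simp
  · simp only [whiskerLeft_comp, Category.assoc, hγ', hγ]
  · simp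

/-! ### Density of representables and left Kan extensions of presheaf-valued functors. -/

section Density

variable {C : Type u} [SmallCategory C] {E : Type*} [Category* E]

/-- `L` preserves the canonical presentation of a presheaf `P` as a colimit of representables, so
the maps `φ_c ≫ L' t`, for `t : y c ⟶ P`, form a cocone inducing the component at `P`. Nothing is
needed of `L'`. -/
theorem existsUnique_whiskerLeft_yoneda (L L' : (Cᵒᵖ ⥤ Type u) ⥤ E)
    [PreservesColimitsOfSize.{u, u} L] (φ : yoneda ⋙ L ⟶ yoneda ⋙ L') :
    ∃! γ : L ⟶ L', Functor.whiskerLeft yoneda γ = φ := by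
  have key (P : Cᵒᵖ ⥤ Type u) : ∃ γ : L.obj P ⟶ L'.obj P,
      ∀ (c : C) (t : yoneda.obj c ⟶ P), L.map t ≫ γ = φ.app c ≫ L'.map t := by
    refine ⟨(isColimitOfPreserves L (Presheaf.isColimitTautologicalCocone P)).desc
      { pt := L'.obj P
        ι :=
          { app := fun j => φ.app j.left ≫ L'.map j.hom
            naturality := fun i j m => ?_ } }, fun c t => ?_⟩
    · refine Eq.trans ?_ (Category.comp_id _).symm
      refine (Category.assoc _ _ _).symm.trans ((congrArg (· ≫ _) (φ.naturality m.left)).trans ?_)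
      refine (Category.assoc _ _ _).trans (congrArg (φ.app i.left ≫ ·) ?_)
      refine (L'.map_comp _ _).symm.trans (congrArg L'.map ?_)
      exact CostructuredArrow.w m
    · exact (isColimitOfPreserves L (Presheaf.isColimitTautologicalCocone P)).fac _
        (CostructuredArrow.mk t)
  have ext (P : Cᵒᵖ ⥤ Type u) (Z : E) (a b : L.obj P ⟶ Z)
      (h : ∀ (c : C) (t : yoneda.obj c ⟶ P), L.map t ≫ a = L.map t ≫ b) : a = b :=
    (isColimitOfPreserves L (Presheaf.isColimitTautologicalCocone P)).hom_ext
      fun j => h j.left j.hom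
  choose γ hγ using key
  refine ⟨{ app := γ, naturality := fun P Q m => ?_ }, ?_, ?_⟩
  · refine ext _ _ _ _ fun c t => ?_
    rw [← Category.assoc, ← L.map_comp, hγ, ← Category.assoc, hγ, Category.assoc, L'.map_comp]
  · ext c
    have := hγ (yoneda.obj c) c (𝟙 _)
    rw [L.map_id, L'.map_id] at this
    exact (Category.id_comp _).symm.trans (this.trans (Category.comp_id _))
  · rintro γ' rfl
    ext P
    refine ext _ _ _ _ fun c t => ?_
    rw [hγ]
    exact γ'.naturality t

theorem presheaf_hom_ext_yoneda {P Q : Cᵒᵖ ⥤ Type u} {φ φ' : P ⟶ Q}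
    (h : ∀ (c : C) (t : yoneda.obj c ⟶ P), t ≫ φ = t ≫ φ') : φ = φ' := by
  ext c s
  have := congrArg yonedaEquiv (h c.unop (yonedaEquiv.symm s))
  rw [yonedaEquiv_comp, yonedaEquiv_comp, Equiv.apply_symm_apply] at this
  exact this

theorem exists_presheaf_hom {P Q : Cᵒᵖ ⥤ Type u}
    (ν : ∀ c : C, (yoneda.obj c ⟶ P) → (yoneda.obj c ⟶ Q))
    (hν : ∀ (c c' : C) (m : c' ⟶ c) (t : yoneda.obj c ⟶ P),
      ν c' (yoneda.map m ≫ t) = yoneda.map m ≫ ν c t) :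
    ∃ φ : P ⟶ Q, ∀ (c : C) (t : yoneda.obj c ⟶ P), t ≫ φ = ν c t := by
  refine ⟨{ app := fun c => ↾fun s => yonedaEquiv (ν c.unop (yonedaEquiv.symm s))
            naturality := fun c d m => ?_ }, fun c t => ?_⟩
  · ext s
    change yonedaEquiv (ν d.unop (yonedaEquiv.symm (P.map m.unop.op s))) =
      Q.map m.unop.op (yonedaEquiv (ν c.unop (yonedaEquiv.symm s)))
    rw [yonedaEquiv_symm_map, hν, yonedaEquiv_naturality']
  · apply yonedaEquiv.injective
    rw [yonedaEquiv_comp]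
    change yonedaEquiv (ν c (yonedaEquiv.symm (yonedaEquiv t))) = _
    rw [Equiv.symm_apply_apply]

variable {F : Type*} [Category* F]

/-- At each `c`, the functor `A ↦ (p A)(c)` is represented by `p' (y c)`, and `A ↦ (r A)(c)` by `r'
(y c) ≅ f (p' (y c))`. The left Kan extension of a representable functor along `f` is represented by
the image of the representing object, so `r` extends `p` along `f`. The condition `hμ` says that `μ`
is the mate of `τ`. The universal property holds against all functors `K`, not only left exact ones.
-/
theorem existsUnique_comp_whiskerLeft {f : E ⥤ F} {p' : (Cᵒᵖ ⥤ Type u) ⥤ E}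
    {p : E ⥤ Cᵒᵖ ⥤ Type u} {r' : (Cᵒᵖ ⥤ Type u) ⥤ F} {r : F ⥤ Cᵒᵖ ⥤ Type u}
    (adjp : p' ⊣ p) (adjr : r' ⊣ r) (τ : r' ⟶ p' ⋙ f) [∀ c, IsIso (τ.app (yoneda.obj c))]
    (μ : p ⟶ f ⋙ r)
    (hμ : ∀ (X : Cᵒᵖ ⥤ Type u) (A : E) (s : X ⟶ p.obj A),
      (adjr.homEquiv _ _).symm (s ≫ μ.app A) = τ.app X ≫ f.map ((adjp.homEquiv _ _).symm s))
    (K : F ⥤ Cᵒᵖ ⥤ Type u) (β : p ⟶ f ⋙ K) : ∃! γ : r ⟶ K, μ ≫ f.whiskerLeft γ = β := by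
  -- The Yoneda recipe: the universal section of `p` is its unit at `y c`; `β` sends it into `K`,
  -- and the map `f (p' (y c)) ⟶ A` corresponding to `t` carries it to `K A`.
  let ν (A : F) (c : C) (t : yoneda.obj c ⟶ r.obj A) : yoneda.obj c ⟶ K.obj A :=
    adjp.unit.app (yoneda.obj c) ≫ β.app _ ≫
      K.map (inv (τ.app (yoneda.obj c)) ≫ (adjr.homEquiv _ _).symm t)
  have hν (A : F) (c c' : C) (m : c' ⟶ c) (t : yoneda.obj c ⟶ r.obj A) :
      ν A c' (yoneda.map m ≫ t) = yoneda.map m ≫ ν A c t := by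
    have h₁ : inv (τ.app (yoneda.obj c')) ≫ r'.map (yoneda.map m) =
        f.map (p'.map (yoneda.map m)) ≫ inv (τ.app (yoneda.obj c)) := by
      rw [IsIso.inv_comp_eq, ← Category.assoc, IsIso.eq_comp_inv]
      exact τ.naturality _
    have h₂ := β.naturality (p'.map (yoneda.map m))
    have h₃ := adjp.unit.naturality (yoneda.map m)
    dsimp at h₂ h₃
    dsimp only [ν]
    rw [Adjunction.homEquiv_naturality_left_symm, reassoc_of% h₁, reassoc_of% h₃,
      reassoc_of% h₂, K.map_comp]
  choose γ hγ using fun A => exists_presheaf_hom (ν A) (hν A)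
  have hν' (A : E) (c : C) (s : yoneda.obj c ⟶ p.obj A) :
      ν _ c (s ≫ μ.app A) = s ≫ β.app A := by
    have h₂ := β.naturality ((adjp.homEquiv _ _).symm s)
    dsimp at h₂
    dsimp only [ν]
    rw [hμ, IsIso.inv_hom_id_assoc, ← h₂, ← Category.assoc]
    congr 1
    rw [← Adjunction.homEquiv_unit, Equiv.apply_symm_apply]
  refine ⟨{ app := γ, naturality := fun A B m => presheaf_hom_ext_yoneda fun c t => ?_ }, ?_, ?_⟩
  · rw [← Category.assoc, ← Category.assoc, hγ, hγ]
    dsimp only [ν]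
    rw [Adjunction.homEquiv_naturality_right_symm]
    simp only [Functor.map_comp, Category.assoc]
  · ext A : 2
    refine presheaf_hom_ext_yoneda fun c s => ?_
    change s ≫ μ.app A ≫ γ _ = _
    rw [← Category.assoc, hγ, hν']
  · rintro γ' rfl
    ext A : 2
    refine presheaf_hom_ext_yoneda fun c t => ?_
    rw [hγ]
    have h₁ := γ'.naturality (inv (τ.app (yoneda.obj c)) ≫ (adjr.homEquiv _ _).symm t)
    -- The image under `μ` of the universal section is the transpose of `τ`, so each section `t` of
    -- `r A` is obtained from it by functoriality. This forces uniqueness.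
    have h₂ : adjp.unit.app (yoneda.obj c) ≫ μ.app (p'.obj (yoneda.obj c)) =
        adjr.homEquiv _ (f.obj (p'.obj (yoneda.obj c))) (τ.app (yoneda.obj c)) := by
      rw [← Equiv.symm_apply_eq, hμ, Adjunction.homEquiv_counit]
      simp
    dsimp only [ν]
    change t ≫ γ'.app A = _ ≫ (μ.app _ ≫ γ'.app _) ≫ _
    dsimp only [Functor.comp_obj] at h₁ ⊢
    rw [Category.assoc, ← h₁, reassoc_of% h₂, ← Category.assoc,
      ← Adjunction.homEquiv_naturality_right, IsIso.hom_inv_id_assoc, Equiv.apply_symm_apply]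

end Density

theorem homEquiv_symm_comp_conjugateEquiv {E G : Type*} [Category* E] [Category* G]
    {L₁ L₂ : G ⥤ E} {R₁ R₂ : E ⥤ G} (adj₁ : L₁ ⊣ R₁) (adj₂ : L₂ ⊣ R₂) (α : L₂ ⟶ L₁) {X : G} {A : E}
    (s : X ⟶ R₁.obj A) : (adj₂.homEquiv X A).symm (s ≫ (conjugateEquiv adj₁ adj₂ α).app A) =
      α.app X ≫ (adj₁.homEquiv X A).symm s := by
  rw [Adjunction.homEquiv_counit, Adjunction.homEquiv_counit, L₂.map_comp, Category.assoc,
    conjugateEquiv_counit, ← Category.assoc, ← Category.assoc, α.naturality]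

/-! ### Right Kan extensions of geometric morphisms into presheaf topoi. -/

namespace Topos

variable {E F G : Topos.{u}} {f : E ⟶ F} {p : E ⟶ G} {r : F ⟶ G}

/-- The transpose of a 2-cell `f ≫ r ⟶ p` along the adjunction of `f`. -/
def transpose (κ : f ≫ r ⟶ p) : GeomMor.inverse r ⟶ GeomMor.inverse p ⋙ GeomMor.direct f where
  app X := f.adj.homEquiv _ _ ((Hom₂.nat κ).app X)
  naturality X Y m := by
    have := (Hom₂.nat κ).naturality m
    dsimp at this ⊢
    rw [← Adjunction.homEquiv_naturality_left, ← Adjunction.homEquiv_naturality_right, this]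

theorem transpose_injective : Function.Injective
    (transpose : (f ≫ r ⟶ p) → (GeomMor.inverse r ⟶ GeomMor.inverse p ⋙ GeomMor.direct f)) := by
  intro κ κ' h
  ext X
  exact (f.adj.homEquiv _ _).injective (congr_app h X)

theorem transpose_surjective : Function.Surjective
    (transpose : (f ≫ r ⟶ p) → (GeomMor.inverse r ⟶ GeomMor.inverse p ⋙ GeomMor.direct f)) := by
  intro τ
  refine ⟨mk₂ (f := f ≫ r)
    { app := fun X => (f.adj.homEquiv _ _).symm (τ.app X)
      naturality := fun X Y m => ?_ }, ?_⟩
  · have := τ.naturality m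
    dsimp at this ⊢
    rw [← Adjunction.homEquiv_naturality_left_symm, ← Adjunction.homEquiv_naturality_right_symm,
      this]
  · ext X
    exact Equiv.apply_symm_apply _ _

theorem transpose_whiskerLeft_comp {y : F ⟶ G} (γ : y ⟶ r) (κ : f ≫ r ⟶ p) :
    transpose (f ◁ γ ≫ κ) = Hom₂.nat γ ≫ transpose κ := by
  ext X
  exact f.adj.homEquiv_naturality_left _ _

/-- In terms of inverse images, a right Kan extension is a terminal inverse image functor over `f_*
p^*`, which need not itself be an inverse image. -/
theorem isRan_iff (κ : f ≫ r ⟶ p) : IsRan r κ ↔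
    ∀ (y : F ⟶ G) (b : GeomMor.inverse y ⟶ GeomMor.inverse p ⋙ GeomMor.direct f),
      ∃! γ : GeomMor.inverse y ⟶ GeomMor.inverse r, γ ≫ transpose κ = b := by
  constructor
  · intro h y b
    obtain ⟨β, rfl⟩ := transpose_surjective b
    obtain ⟨γ, hγ, hu⟩ := h y β
    refine ⟨γ.nat, ?_, fun γ' h' => ?_⟩
    · dsimp only
      rw [← transpose_whiskerLeft_comp, hγ]
    · rw [← hu (mk₂ γ')]
      · rfl
      · apply transpose_injective
        rw [transpose_whiskerLeft_comp]
        exact h'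
  · intro h y β
    obtain ⟨γ, hγ, hu⟩ := h y (transpose β)
    refine ⟨mk₂ γ, ?_, fun γ' h' => ?_⟩
    · apply transpose_injective
      rw [transpose_whiskerLeft_comp]
      exact hγ
    · ext : 1
      refine hu _ ?_
      dsimp only
      rw [← transpose_whiskerLeft_comp, h']

/-- Relates the mate on direct images to the transpose on inverse images; this is the hypothesis
`hμ` of `existsUnique_comp_whiskerLeft`. -/
theorem homEquiv_symm_comp_mate (κ : f ≫ r ⟶ p) {X : G} {A : E}
    (s : X ⟶ (GeomMor.direct p).obj A) :
    (r.adj.homEquiv X _).symm (s ≫ (mate κ).app A) =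
      (transpose κ).app X ≫ (GeomMor.direct f).map ((p.adj.homEquiv X A).symm s) := by
  have h := homEquiv_symm_comp_conjugateEquiv p.adj (r.adj.comp f.adj) (Hom₂.nat κ) s
  rw [Adjunction.comp_homEquiv, Equiv.symm_trans_apply, Equiv.symm_apply_eq] at h
  refine h.trans ?_
  exact f.adj.homEquiv_naturality_right _ _

section Presheaves

variable {C : Type u} [SmallCategory C] {p : E ⟶ psh C} {r : F ⟶ psh C}

theorem preservesColimits_inverse_psh (r : F ⟶ psh C) :
    PreservesColimitsOfSize.{u, u} (C := Cᵒᵖ ⥤ Type u) (GeomMor.inverse r) :=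
  r.adj.leftAdjoint_preservesColimits

theorem existsUnique_whiskerLeft_inverse (r : F ⟶ psh C) (L : (Cᵒᵖ ⥤ Type u) ⥤ F)
    (φ : yoneda ⋙ GeomMor.inverse r ⟶ yoneda ⋙ L) :
    ∃! γ : GeomMor.inverse r ⟶ L, Functor.whiskerLeft yoneda γ = φ :=
  have := preservesColimits_inverse_psh r
  @existsUnique_whiskerLeft_yoneda C _ F _ (GeomMor.inverse r) L this φ

/-- By density, an equation `γ' ≫ transpose κ = b` can be tested on representables, where it is
solved uniquely by inverting the transpose. -/
theorem isRan_of_isIso_transpose (κ : f ≫ r ⟶ p)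
    (h : IsIso (Functor.whiskerLeft yoneda (transpose κ))) : IsRan r κ := by
  rw [isRan_iff]
  intro y b
  obtain ⟨γ, hγ, hu⟩ := existsUnique_whiskerLeft_inverse y (GeomMor.inverse r)
    (Functor.whiskerLeft yoneda b ≫ inv (Functor.whiskerLeft yoneda (transpose κ)))
  have key (γ' : GeomMor.inverse y ⟶ GeomMor.inverse r) : γ' ≫ transpose κ = b ↔
      Functor.whiskerLeft yoneda γ' =
        Functor.whiskerLeft yoneda b ≫ inv (Functor.whiskerLeft yoneda (transpose κ)) := by
    rw [IsIso.eq_comp_inv]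
    exact ⟨fun h => congrArg (fun τ => Functor.whiskerLeft yoneda τ) h, fun h =>
      (existsUnique_whiskerLeft_inverse _ _ (Functor.whiskerLeft yoneda b)).unique h rfl⟩
  exact ⟨γ, (key γ).2 hγ, fun γ' h' => hu _ ((key γ').1 h')⟩

variable [HasFiniteLimits C]

/-- The functor `f_* p^* y` is left exact, so Diaconescu's theorem yields `r` with `r^* y ≅ f_* p^*
y`. Density extends this isomorphism to a transformation on all presheaves, which is then transposed
back to the counit. -/
theorem exists_isRan_psh (f : E ⟶ F) (p : E ⟶ psh C) :
    ∃ (r : F ⟶ psh C) (κ : f ≫ r ⟶ p), IsRan r κ ∧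
      IsIso (Functor.whiskerLeft yoneda (transpose κ)) := by
  let p' : (Cᵒᵖ ⥤ Type u) ⥤ E := GeomMor.inverse p
  have : PreservesFiniteLimits p' := p.lex
  have : PreservesFiniteLimits (GeomMor.direct f) :=
    have := f.adj.rightAdjoint_preservesLimits
    PreservesLimitsOfSize.preservesFiniteLimits.{0, 0} _
  have : PreservesFiniteLimits (yoneda : C ⥤ Cᵒᵖ ⥤ Type u) :=
    PreservesLimitsOfSize.preservesFiniteLimits.{0, 0} _
  have : PreservesFiniteLimits (p' ⋙ GeomMor.direct f) :=
    comp_preservesFiniteLimits _ _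
  have : PreservesFiniteLimits (yoneda ⋙ p' ⋙ GeomMor.direct f) :=
    comp_preservesFiniteLimits _ _
  obtain ⟨r, ⟨e⟩⟩ := exists_geomMor_of_lex F (yoneda ⋙ p' ⋙ GeomMor.direct f)
  obtain ⟨τ, hτ, -⟩ := existsUnique_whiskerLeft_inverse r
    (GeomMor.inverse p ⋙ GeomMor.direct f) e.hom
  obtain ⟨κ, rfl⟩ := transpose_surjective τ
  have h : IsIso (Functor.whiskerLeft yoneda (transpose κ)) :=
    hτ ▸ (inferInstance : IsIso e.hom)
  exact ⟨r, κ, isRan_of_isIso_transpose κ h, h⟩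

/-- Right Kan extensions are unique up to isomorphism, so any of them inherits the property from the
one constructed by Diaconescu's theorem. -/
theorem isIso_transpose_of_isRan {κ : f ≫ r ⟶ p} (h : IsRan r κ) (c : C) :
    IsIso ((transpose κ).app (yoneda.obj c)) := by
  obtain ⟨r', κ', h', hi⟩ := exists_isRan_psh f p
  obtain ⟨e, he⟩ := h'.exists_iso h
  have h₁ : IsIso ((Functor.whiskerLeft yoneda (transpose κ')).app c) := inferInstance
  rw [← he, transpose_whiskerLeft_comp] at h₁
  have h₂ : IsIso ((Hom₂.nat e.hom).app (yoneda.obj c)) :=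
    ⟨(Hom₂.nat e.inv).app (yoneda.obj c),
      congr_app (congrArg Hom₂.nat e.hom_inv_id) (yoneda.obj c),
      congr_app (congrArg Hom₂.nat e.inv_hom_id) (yoneda.obj c)⟩
  have h₃ : IsIso ((Hom₂.nat e.hom).app (yoneda.obj c) ≫ (transpose κ).app (yoneda.obj c)) := h₁
  exact IsIso.of_isIso_comp_left ((Hom₂.nat e.hom).app (yoneda.obj c)) _

theorem isPointwise_of_isRan {κ : f ≫ r ⟶ p} (h : IsRan r κ) : IsPointwise r κ := by
  have hi := isIso_transpose_of_isRan h
  exact ⟨have := r.adj.rightAdjoint_preservesLimits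
    PreservesLimitsOfSize.preservesFiniteLimits.{0, 0} _, fun K _ β =>
    existsUnique_comp_whiskerLeft p.adj r.adj (transpose κ) (mate κ)
      (fun X A s => homEquiv_symm_comp_mate κ s) K β⟩

end Presheaves

end Topos

/-! ### Topologies for which all direct images are sheaves. -/

section Sieves

variable {C : Type u} [SmallCategory C] {F : Type*} [Category* F] {L : (Cᵒᵖ ⥤ Type u) ⥤ F}
  {R : F ⥤ Cᵒᵖ ⥤ Type u} (adj : L ⊣ R) [PreservesFiniteLimits L]

include adj in
-- As `m` factors through `S`, the map `L S ⟶ L (y c)` is a split epimorphism; it is mono since `L`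
-- is left exact, hence invertible. By adjunction, maps from `S` to `R A` then extend uniquely to `y
-- c`.
theorem isSheafFor_of_isIso_map {c : C} (S : Sieve c) {P : Cᵒᵖ ⥤ Type u} (m : P ⟶ yoneda.obj c)
    (hm : ∀ (d : C) (x : P.obj (op d)), S.arrows (m.app (op d) x)) [IsIso (L.map m)] (A : F) :
    Presieve.IsSheafFor (R.obj A) S.arrows := by
  let n : P ⟶ S.functor :=
    { app := fun d => ↾fun x => ⟨m.app d x, hm d.unop x⟩
      naturality := fun d d' k => by
        ext x
        exact Subtype.ext (ConcreteCategory.congr_hom (m.naturality k) x :) }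
  have hn : n ≫ S.functorInclusion = m := rfl
  have : IsSplitEpi (L.map S.functorInclusion) :=
    ⟨⟨⟨inv (L.map m) ≫ L.map n, by rw [Category.assoc, ← L.map_comp, hn, IsIso.inv_hom_id]⟩⟩⟩
  have : Mono (L.map S.functorInclusion) := inferInstance
  have hi : IsIso (L.map S.functorInclusion) := isIso_of_mono_of_isSplitEpi _
  rw [Presieve.isSheafFor_iff_yonedaSheafCondition]
  intro g
  refine ⟨adj.homEquiv _ _ (inv (L.map S.functorInclusion) ≫ (adj.homEquiv _ _).symm g),
    ?_, fun g' hg' => ?_⟩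
  · dsimp only
    rw [← Adjunction.homEquiv_naturality_left, IsIso.hom_inv_id_assoc, Equiv.apply_symm_apply]
  · rw [← hg', Adjunction.homEquiv_naturality_left_symm, IsIso.inv_hom_id_assoc,
      Equiv.apply_symm_apply]

/-- The finest topology for which all objects in the image of `R` are sheaves. -/
abbrev directImageTopology (R : F ⥤ Cᵒᵖ ⥤ Type u) : GrothendieckTopology C :=
  Sheaf.finestTopology (Set.range R.obj)

include adj in
-- Covering for the finest topology requires the sheaf condition for every pullback of `S`, so a
-- witness `P` is asked for over each `k`.
theorem mem_directImageTopology {c : C} (S : Sieve c)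
    (h : ∀ (d : C) (k : d ⟶ c), ∃ (P : Cᵒᵖ ⥤ Type u) (m : P ⟶ yoneda.obj d),
      (∀ (e : C) (x : P.obj (op e)), S.arrows (m.app (op e) x ≫ k)) ∧ IsIso (L.map m)) :
    S ∈ directImageTopology R c := by
  refine Sheaf.mem_finestTopology_of_forall_isSheafFor ?_
  rintro _ ⟨A, rfl⟩ d k
  obtain ⟨P, m, hm, _⟩ := h d k
  exact isSheafFor_of_isIso_map adj _ m hm A

include adj in
-- The witnesses are finite limits, which `L` preserves. Two sections identified by `φ` become equal
-- under `L`, so their equalizer is sent to an isomorphism; the pullback of `φ` along a section is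
-- sent to a pullback of the isomorphism `L φ`.
theorem isLocallyBijective_of_isIso_map {X Y : Cᵒᵖ ⥤ Type u} (φ : X ⟶ Y) [IsIso (L.map φ)] :
    Presheaf.IsLocallyInjective (directImageTopology R) φ ∧
      Presheaf.IsLocallySurjective (directImageTopology R) φ := by
  refine ⟨⟨fun {c} x y h => mem_directImageTopology adj _ fun d k => ?_⟩,
    ⟨fun {c} s => mem_directImageTopology adj _ fun d k => ?_⟩⟩
  · let a : yoneda.obj d ⟶ X := yonedaEquiv.symm (X.map k.op x)
    let b : yoneda.obj d ⟶ X := yonedaEquiv.symm (X.map k.op y)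
    have hab : a ≫ φ = b ≫ φ := by
      apply yonedaEquiv.injective
      rw [yonedaEquiv_comp, yonedaEquiv_comp]
      dsimp only [a, b]
      rw [Equiv.apply_symm_apply, Equiv.apply_symm_apply, NatTrans.naturality_apply,
        NatTrans.naturality_apply, h]
    have hL : L.map a = L.map b := by
      rw [← cancel_mono (L.map φ), ← L.map_comp, ← L.map_comp, hab]
    refine ⟨equalizer a b, equalizer.ι a b, fun e z => ?_, ?_⟩
    · have := ConcreteCategory.congr_hom (congr_app (equalizer.condition a b) (op e)) z
      change X.map ((equalizer.ι a b).app (op e) z).op (X.map k.op x) =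
        X.map ((equalizer.ι a b).app (op e) z).op (X.map k.op y) at this
      simpa using this
    · exact isIso_limit_cone_parallelPair_of_eq hL
        (isLimitForkMapOfIsLimit L _ (equalizerIsEqualizer a b))
  · let a : yoneda.obj d ⟶ Y := yonedaEquiv.symm (Y.map k.op s)
    refine ⟨pullback φ a, pullback.snd φ a, fun e z => ?_, ?_⟩
    · have := ConcreteCategory.congr_hom (congr_app (pullback.condition (f := φ) (g := a)) (op e)) z
      refine ⟨(pullback.fst φ a).app _ z, ?_⟩
      change φ.app (op e) ((pullback.fst φ a).app (op e) z) =
        Y.map ((pullback.snd φ a).app (op e) z).op (Y.map k.op s) at this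
      simpa using this
    · exact ((IsPullback.of_hasPullback φ a).map L).isIso_snd_of_isIso

end Sieves

/-! ### Factoring through sheaves, and what embeddings reflect. -/

namespace Topos

variable {E F X Y : Topos.{u}}

/-- The direct image corestricts to sheaves, and `r^*` restricted to sheaves is still its left
adjoint because sheaves are a full subcategory. -/
theorem exists_factor_sh {C : Type u} [SmallCategory C] (J : GrothendieckTopology C)
    (r : F ⟶ psh C) (h : ∀ A : F, Presheaf.IsSheaf J (P := (GeomMor.direct r).obj A)) :
    ∃ r' : F ⟶ sh J, Nonempty (r' ≫ shIncl J ≅ r) := by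
  let d : F ⥤ Sheaf J (Type u) := ObjectProperty.lift _ (GeomMor.direct r) h
  let i : Sheaf J (Type u) ⥤ F := sheafToPresheaf J (Type u) ⋙ GeomMor.inverse r
  have adj : i ⊣ d := r.adj.restrictFullyFaithful (fullyFaithfulSheafToPresheaf J (Type u))
    (Functor.FullyFaithful.id F) (Iso.refl _) (Iso.refl _)
  have h₁ : PreservesFiniteLimits (sheafToPresheaf J (Type u)) :=
    PreservesLimitsOfSize.preservesFiniteLimits.{0, 0} _
  exact ⟨⟨d, i, adj, @comp_preservesFiniteLimits _ _ _ _ _ _ _ _ h₁ r.lex⟩, ⟨isoOfMate (Iso.refl _)⟩⟩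

namespace IsEmbedding

variable {j : X ⟶ Y} (hj : IsEmbedding j)
include hj

theorem whiskerRight_injective {a b : F ⟶ X} {γ γ' : a ⟶ b} (h : γ ▷ j = γ' ▷ j) : γ = γ' := by
  have := hj.1
  have := hj.2
  apply mate_injective
  ext A
  apply (GeomMor.direct j).map_injective
  have := congr_app (congrArg mate h) A
  rwa [mate_whiskerRight, mate_whiskerRight] at this

theorem exists_whiskerRight {a b : F ⟶ X} (θ : a ≫ j ⟶ b ≫ j) : ∃ γ : a ⟶ b, γ ▷ j = θ := by
  have := hj.1
  have := hj.2
  refine ⟨ofMate (((Functor.FullyFaithful.ofFullyFaithful (GeomMor.direct j)).whiskeringRight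
    F).preimage (mate θ)), ?_⟩
  apply mate_injective
  rw [mate_whiskerRight, mate_ofMate]
  exact ((Functor.FullyFaithful.ofFullyFaithful (GeomMor.direct j)).whiskeringRight
    F).map_preimage (mate θ)

/-- Since `j_*` is fully faithful, passing to mates shows that whiskering with `j` is bijective on
2-cells. The universal property tested against `y ≫ j` is therefore that tested against `y`. -/
theorem isRan_of_isRan {f : E ⟶ F} {p : E ⟶ X} {r : F ⟶ X} {κ : f ≫ r ⟶ p}
    (h : IsRan (r ≫ j) ((α_ f r j).inv ≫ κ ▷ j)) : IsRan r κ := by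
  intro y β
  have key (γ : y ⟶ r) : f ◁ (γ ▷ j) ≫ (α_ f r j).inv ≫ κ ▷ j = (α_ f y j).inv ≫ β ▷ j ↔
      f ◁ γ ≫ κ = β := by
    rw [associator_inv_naturality_middle_assoc, ← comp_whiskerRight, Iso.cancel_iso_inv_left]
    exact ⟨hj.whiskerRight_injective, fun h => h ▸ rfl⟩
  obtain ⟨θ, hθ, hu⟩ := h (y ≫ j) ((α_ f y j).inv ≫ β ▷ j)
  obtain ⟨γ, rfl⟩ := hj.exists_whiskerRight θ
  exact ⟨γ, (key γ).1 hθ, fun γ' h' => hj.whiskerRight_injective (hu _ ((key γ').2 h'))⟩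

theorem preservesRan_of_comp {f : E ⟶ F} {Z : Topos.{u}} {h : Z ⟶ X}
    (hh : PreservesRan f (h ≫ j)) : PreservesRan f h := by
  intro p r κ H
  refine hj.isRan_of_isRan ((hh p r κ H).of_iso (α_ r h j).symm (α_ p h j).symm ?_)
  simp

/-- The same reflection for direct images: a left exact `K` is tested through `K ⋙ j_*`, which is
left exact since `j_*` is a right adjoint. -/
theorem isPointwise_of_isPointwise {f : E ⟶ F} {p : E ⟶ X} {r : F ⟶ X} {κ : f ≫ r ⟶ p}
    (h : IsPointwise (r ≫ j) ((α_ f r j).inv ≫ κ ▷ j)) : IsPointwise r κ := by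
  have := hj.1
  have := hj.2
  have hd : PreservesFiniteLimits (GeomMor.direct j) :=
    have := j.adj.rightAdjoint_preservesLimits
    PreservesLimitsOfSize.preservesFiniteLimits.{0, 0} _
  let ff := (Functor.FullyFaithful.ofFullyFaithful (GeomMor.direct j)).whiskeringRight F
  let ff' := (Functor.FullyFaithful.ofFullyFaithful (GeomMor.direct j)).whiskeringRight E
  refine ⟨have := r.adj.rightAdjoint_preservesLimits
    PreservesLimitsOfSize.preservesFiniteLimits.{0, 0} _, fun K hK β => ?_⟩
  have hm : mate ((α_ f r j).inv ≫ κ ▷ j) = Functor.whiskerRight (mate κ) (GeomMor.direct j) := by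
    rw [mate_comp, mate_whiskerRight, mate_associator_inv]
    exact Category.comp_id _
  obtain ⟨θ, hθ, hu⟩ := h.2 (K ⋙ GeomMor.direct j) (comp_preservesFiniteLimits _ _)
    (Functor.whiskerRight β (GeomMor.direct j))
  have key (γ : GeomMor.direct r ⟶ K) : mate ((α_ f r j).inv ≫ κ ▷ j) ≫
      Functor.whiskerLeft (GeomMor.direct f) (Functor.whiskerRight γ (GeomMor.direct j)) =
        Functor.whiskerRight β (GeomMor.direct j) ↔
      mate κ ≫ Functor.whiskerLeft (GeomMor.direct f) γ = β := by
    have hc : mate ((α_ f r j).inv ≫ κ ▷ j) ≫ Functor.whiskerLeft (GeomMor.direct f)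
        (Functor.whiskerRight γ (GeomMor.direct j)) =
          Functor.whiskerRight (mate κ ≫ Functor.whiskerLeft (GeomMor.direct f) γ)
            (GeomMor.direct j) := by
      rw [hm, Functor.whiskerRight_comp]
      rfl
    rw [hc]
    exact ⟨fun h => ff'.map_injective h, fun h => congrArg (fun τ => Functor.whiskerRight τ _) h⟩
  refine ⟨ff.preimage θ, (key _).1 ?_, fun γ' h' => ?_⟩
  · exact (congrArg _ (congrArg _ (ff.map_preimage θ))).trans hθ
  · exact ff.map_injective ((hu _ ((key _).2 h')).trans (ff.map_preimage θ).symm)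

end IsEmbedding

end Topos

/-! ### Kan extensions into the classifying topos. -/

section

open Topos

variable {H : Logic.{u}} {E F : Topos.{u}} {f : E ⟶ F}

/-- The classifying map `q` of `X` preserves the extension, and its target is itself a presheaf
topos in which the generic object is representable. Invertibility there is invertibility of the
transpose of `κ` at `q^* generic ≅ X`. -/
theorem isIso_transpose_of_mem_freeSyn {C : Type u} [SmallCategory C] [HasFiniteLimits C]
    {X : Cᵒᵖ ⥤ Type u} (hX : freeSyn H C X) (hf : H f) {p : E ⟶ psh C} {r : F ⟶ psh C}
    {κ : f ≫ r ⟶ p} (h : IsRan r κ) : IsIso ((transpose κ).app X) := by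
  obtain ⟨q, hq, ⟨e⟩⟩ := hX
  have h₁ := isIso_transpose_of_isRan (C := FintypeCat.Skeleton.{u}ᵒᵖ) (hq f hf p r κ h)
    (op (FintypeCat.Skeleton.mk 1))
  -- The whiskered counit at the generic object is `κ` at its inverse image, up to composition with
  -- an associator component, which is an identity.
  have h₂ : IsIso ((transpose κ).app ((GeomMor.inverse q).obj generic)) := by
    refine cast ?_ h₁
    congr 1
    refine congrArg (f.adj.homEquiv _ _) ?_
    exact Category.id_comp _
  exact (NatTrans.isIso_app_iff_of_iso (transpose κ) e).1 h₂

namespace Cl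

theorem isEmbedding_incl (A : Alg H) : IsEmbedding (Cl.incl A) :=
  ⟨inferInstanceAs (sheafToPresheaf A.topology (Type u)).Full,
    inferInstanceAs (sheafToPresheaf A.topology (Type u)).Faithful⟩

theorem isIso_inverse_incl_map_δ (A : Alg H) (X : T H A.carrier) :
    IsIso ((GeomMor.inverse (Cl.incl A)).map (A.δ X)) :=
  (A.topology.W_iff (A := Type u) _).1
    ((A.topology.W_iff_isLocallyBijective _).2 (A.isLocallyBijective_δ X))

/-- If `r^*` inverts each `δ_X`, then `δ_X` is locally bijective for the finest topology making all
`r_* Z` sheaves. Minimality of `A.topology` places it below that one, so every `r_* Z` is a sheaf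
for it. -/
theorem exists_factor_incl (A : Alg H) (r : F ⟶ psh A.carrier)
    (h : ∀ X : T H A.carrier, IsIso ((GeomMor.inverse r).map (A.δ X))) :
    ∃ r' : F ⟶ Cl.obj A, Nonempty (r' ≫ Cl.incl A ≅ r) := by
  refine exists_factor_sh A.topology r fun Z => ?_
  let L : (A.carrierᵒᵖ ⥤ Type u) ⥤ F := GeomMor.inverse r
  have : PreservesFiniteLimits L := r.lex
  have hle : A.topology ≤ directImageTopology (GeomMor.direct r) :=
    A.topology_le _ fun X =>
      have : IsIso (L.map (A.δ X)) := h X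
      isLocallyBijective_of_isIso_map r.adj (A.δ X)
  refine (isSheaf_iff_isSheaf_of_type _ _).2 ?_
  exact Presieve.isSheaf_of_le _ hle (Sheaf.sheaf_for_finestTopology _ ⟨Z, rfl⟩)

theorem exists_isRan (A : Alg H) (hf : H f) (p : E ⟶ Cl.obj A) :
    ∃ (r : F ⟶ Cl.obj A) (κ : f ≫ r ⟶ p), IsRan r κ ∧
      IsRan (r ≫ Cl.incl A) ((α_ f r (Cl.incl A)).inv ≫ κ ▷ Cl.incl A) := by
  obtain ⟨r, κ, h, -⟩ := exists_isRan_psh f (p ≫ Cl.incl A)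
  -- Naturality of the transpose at `δ_X` gives a square with three invertible sides: the transpose
  -- at `X`, the transpose at a representable, and the image of `δ_X` under the inverse image of `p
  -- ≫ Cl.incl A` followed by `f_*`.
  have hδ (X : T H A.carrier) : IsIso ((GeomMor.inverse r).map (A.δ X)) := by
    have h₁ := isIso_transpose_of_mem_freeSyn X.property hf h
    have h₂ := isIso_transpose_of_isRan h (A.a.obj X)
    have h₃ : IsIso ((GeomMor.inverse (p ≫ Cl.incl A) ⋙ GeomMor.direct f).map (A.δ X)) :=
      have := isIso_inverse_incl_map_δ A X
      inferInstanceAs (IsIso ((GeomMor.direct f).map ((GeomMor.inverse p).map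
        ((GeomMor.inverse (Cl.incl A)).map (A.δ X)))))
    have h₄ := (transpose κ).naturality (A.δ X)
    have h₅ : IsIso ((GeomMor.inverse r).map (A.δ X) ≫
        (transpose κ).app (yoneda.obj (A.a.obj X))) := by
      refine (congrArg IsIso h₄).mpr ?_
      infer_instance
    exact IsIso.of_isIso_comp_right _ ((transpose κ).app (yoneda.obj (A.a.obj X)))
  obtain ⟨r', ⟨e⟩⟩ := exists_factor_incl A r hδ
  obtain ⟨κ', hκ'⟩ := (isEmbedding_incl A).exists_whiskerRight
    ((α_ f r' (Cl.incl A)).hom ≫ f ◁ e.hom ≫ κ)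
  have h' : IsRan (r' ≫ Cl.incl A) ((α_ f r' (Cl.incl A)).inv ≫ κ' ▷ Cl.incl A) := by
    refine h.of_iso e.symm (Iso.refl _) ?_
    rw [hκ']
    simp
  exact ⟨r', κ', (isEmbedding_incl A).isRan_of_isRan h', h'⟩

theorem mem_wRInj (A : Alg H) : (WRInj H).ob (Cl.obj A) := fun _ _ _ hf p =>
  let ⟨r, κ, h, _⟩ := exists_isRan A hf p
  ⟨r, κ, h⟩

/-- One preserved extension suffices, since any other is isomorphic to it compatibly with the
counits. -/
theorem incl_mem_wRInj (A : Alg H) : (WRInj H).mor (Cl.incl A) := by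
  intro E F f hf p r κ h
  obtain ⟨r', κ', h₁, h₂⟩ := exists_isRan A hf p
  obtain ⟨e, he⟩ := h₁.exists_iso h
  refine h₂.of_iso (whiskerRightIso e (Cl.incl A)) (Iso.refl _) ?_
  simp [← he]

theorem isPresentation_incl (A : Alg H) : IsPresentation H (Cl.incl A) where
  source_mem := mem_wRInj A
  target_mem _ _ f _ p :=
    let ⟨r, κ, h, _⟩ := exists_isRan_psh f p
    ⟨r, κ, h⟩
  mor_mem := incl_mem_wRInj A
  isEmbedding := isEmbedding_incl A

theorem map_mem_wRInj {A B : Alg H} (g : A ⟶ B) : (WRInj H).mor (Cl.map g) := by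
  intro E F f hf
  have h : PreservesRan f (Cl.incl B ≫ pshMap (AlgHom.functor g)) :=
    (incl_mem_wRInj B f hf).comp (PreservesRan.of_adjunction f (pshMapAdj _))
  refine (isEmbedding_incl A).preservesRan_of_comp fun p r κ H => ?_
  -- Both direct images send a sheaf to its underlying presheaf restricted along `g`, so they agree
  -- definitionally.
  let e : Cl.incl B ≫ pshMap (AlgHom.functor g) ≅ Cl.map g ≫ Cl.incl A :=
    isoOfMate (Iso.refl _)
  refine (h p r κ H).of_iso (whiskerLeftIso r e) (whiskerLeftIso p e) ?_
  change f ◁ r ◁ e.hom ≫ _ = _ ≫ p ◁ e.hom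
  rw [associator_inv_naturality_right_assoc, whisker_exchange, Category.assoc]

theorem mem_wRInjPw (A : Alg H) : (WRInjPw H).ob (Cl.obj A) :=
  ⟨mem_wRInj A, fun _ _ f hf p r κ h => (isEmbedding_incl A).isPointwise_of_isPointwise
    (isPointwise_of_isRan (incl_mem_wRInj A f hf p r κ h))⟩

end Cl

end

/-! ### The pseudofunctor into the pointwise sub-bicategory. -/

namespace Cl

open LocallyFull

variable {H : Logic.{u}} {A B D E : Alg H}

/-- The classifying topos as an object of `WRInjPw H`. -/
def subObj (A : Alg H) : (WRInjPw H).Sub := ⟨Cl.obj A, mem_wRInjPw A⟩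

/-- The geometric morphism induced by a morphism of algebras as a 1-cell of `WRInjPw H`. -/
noncomputable def subMap (g : A ⟶ B) : subObj B ⟶ subObj A := Hom.mk (Cl.map g) (map_mem_wRInj g)

/-- The 2-cell of `WRInjPw H` induced by a 2-cell of algebra morphisms. -/
noncomputable def subMap₂ {g k : A ⟶ B} (η : g ⟶ k) : subMap g ⟶ subMap k :=
  mk₂ (f := subMap g) (g := subMap k) (Cl.map₂ η)

/-- Compatibility with identities. -/
noncomputable def subMapId (A : Alg H) : subMap (𝟙 A) ≅ 𝟙 (subObj A) :=
  isoMk (f := subMap (𝟙 A)) (g := 𝟙 (subObj A)) (Cl.mapId A)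

/-- Compatibility with composition. -/
noncomputable def subMapComp (g : A ⟶ B) (k : B ⟶ D) : subMap (g ≫ k) ≅ subMap k ≫ subMap g :=
  isoMk (f := subMap (g ≫ k)) (g := subMap k ≫ subMap g) (Cl.mapComp g k)

/-- The sub-bicategory has the 2-cells and structure isomorphisms of topoi, so this and the
following coherence laws are those already verified for `Cl`. -/
theorem subMap₂_id (g : A ⟶ B) : subMap₂ (𝟙 g) = 𝟙 (subMap g) :=
  hom₂_ext (Cl.map₂_id g)

theorem subMap₂_comp {g k l : A ⟶ B} (η : g ⟶ k) (θ : k ⟶ l) :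
    subMap₂ (η ≫ θ) = subMap₂ η ≫ subMap₂ θ :=
  hom₂_ext (Cl.map₂_comp η θ)

theorem subMap₂_whisker_left (f : A ⟶ B) {g h : B ⟶ D} (η : g ⟶ h) : subMap₂ (f ◁ η) =
    (subMapComp f g).hom ≫ (subMap₂ η ▷ subMap f) ≫ (subMapComp f h).inv :=
  hom₂_ext (Cl.map₂_whisker_left f η)

theorem subMap₂_whisker_right {f g : A ⟶ B} (η : f ⟶ g) (h : B ⟶ D) : subMap₂ (η ▷ h) =
    (subMapComp f h).hom ≫ (subMap h ◁ subMap₂ η) ≫ (subMapComp g h).inv :=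
  hom₂_ext (Cl.map₂_whisker_right η h)

theorem subMap₂_associator (f : A ⟶ B) (g : B ⟶ D) (h : D ⟶ E) : subMap₂ (α_ f g h).hom =
    (subMapComp (f ≫ g) h).hom ≫ (subMap h ◁ (subMapComp f g).hom) ≫
      (α_ (subMap h) (subMap g) (subMap f)).inv ≫ ((subMapComp g h).inv ▷ subMap f) ≫
        (subMapComp f (g ≫ h)).inv :=
  hom₂_ext (Cl.map₂_associator f g h)

theorem subMap₂_left_unitor (f : A ⟶ B) : subMap₂ (λ_ f).hom =
    (subMapComp (𝟙 A) f).hom ≫ (subMap f ◁ (subMapId A).hom) ≫ (ρ_ (subMap f)).hom :=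
  hom₂_ext (Cl.map₂_left_unitor f)

theorem subMap₂_right_unitor (f : A ⟶ B) : subMap₂ (ρ_ f).hom =
    (subMapComp f (𝟙 B)).hom ≫ ((subMapId B).hom ▷ subMap f) ≫ (λ_ (subMap f)).hom :=
  hom₂_ext (Cl.map₂_right_unitor f)

end Cl

open Bicategory.Opposite in
/-- The classifying topos pseudofunctor with values in `WRInjPw H`. -/
noncomputable def Cl.toWRInjPw (H : Logic.{u}) : Alg H ⥤ᵖ (WRInjPw H).Subᵒᵖ where
  obj A := op (Cl.subObj A)
  map g := (Cl.subMap g).op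
  map₂ η := op2 (Cl.subMap₂ η)
  mapId A := (Cl.subMapId A).op2
  mapComp g k := (Cl.subMapComp g k).op2
  map₂_id g := congrArg op2 (Cl.subMap₂_id g)
  map₂_comp η θ := congrArg op2 (Cl.subMap₂_comp η θ)
  map₂_whisker_left f _ _ η := congrArg op2 (Cl.subMap₂_whisker_left f η)
  map₂_whisker_right η h := congrArg op2 (Cl.subMap₂_whisker_right η h)
  map₂_associator f g h := congrArg op2 (Cl.subMap₂_associator f g h)
  map₂_left_unitor f := congrArg op2 (Cl.subMap₂_left_unitor f)
  map₂_right_unitor f := congrArg op2 (Cl.subMap₂_right_unitor f)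

/-- The factorisation is strict: the inclusion has identity structure cells, so those of the
composite differ from those of `Cl` only by composition with identities. -/
theorem Cl.toWRInjPw_comp_inclOp (H : Logic.{u}) :
    (Cl.toWRInjPw H).comp (WRInjPw H).inclOp = Cl H := by
  have h₁ (A : Alg H) : ((Cl.toWRInjPw H).comp (WRInjPw H).inclOp).mapId A = (Cl H).mapId A := by
    ext : 1
    exact Category.comp_id _
  have h₂ {A B D : Alg H} (g : A ⟶ B) (k : B ⟶ D) :
      ((Cl.toWRInjPw H).comp (WRInjPw H).inclOp).mapComp g k = (Cl H).mapComp g k := by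
    ext : 1
    exact Category.comp_id _
  -- Heterogeneous equality is needed because the types of the structure cells depend on the
  -- underlying prelax functor; the other fields are propositions.
  have key (P Q : Alg H ⥤ᵖ Topos.{u}ᵒᵖ) (h : P.toPrelaxFunctor = Q.toPrelaxFunctor)
      (hi : P.mapId ≍ Q.mapId) (hc : @P.mapComp ≍ @Q.mapComp) : P = Q := by
    cases P
    cases Q
    cases h
    cases hi
    cases hc
    rfl
  refine key _ _ rfl (heq_of_eq (funext h₁)) (heq_of_eq ?_)
  funext A B D g k
  exact h₂ g k

end KanLogic

theorem mainTheorem5 (H : KanLogic.Logic.{u}) :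
    (∀ A : KanLogic.Alg H, (KanLogic.WRInj H).ob (KanLogic.Cl.obj A)) ∧
    (∀ A : KanLogic.Alg H, KanLogic.IsPresentation H (KanLogic.Cl.incl A)) ∧
    (∀ (A B : KanLogic.Alg H) (g : A ⟶ B), (KanLogic.WRInj H).mor (KanLogic.Cl.map g)) ∧
    ∃ F : KanLogic.Alg H ⥤ᵖ (KanLogic.WRInjPw H).Subᵒᵖ,
      F.comp (KanLogic.WRInjPw H).inclOp = KanLogic.Cl H :=
  ⟨KanLogic.Cl.mem_wRInj, KanLogic.Cl.isPresentation_incl,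
    fun _ _ g => KanLogic.Cl.map_mem_wRInj g,
    KanLogic.Cl.toWRInjPw H, KanLogic.Cl.toWRInjPw_comp_inclOp H⟩
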